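/- Let $m\ge 1$, $M=2^m$, and consider the complex-valued discrete-time Gaussian channel $Y=H\sqrt{\mathrm{SNR}}\,X+Z$, where $Z$ is circularly symmetric complex Gaussian noise of unit variance, $H$ is a fading coefficient known at the receiver with $\mathbb{E}[|H|^2]=1$ ($H\equiv 1$ being the unfaded channel), and $X$, $H$, $Z$ are independent. Let the constellation $\mathcal X$ be one of the following, with equiprobable symbols and unit average energy: - $M$-PAM, $\mathcal X=\{\pm\beta,\pm3\beta,\dots,\pm(M-1)\beta\}$ with $\beta^2=3/(M^2-1)$, the points in increasing order being labelled by the successive words of the binary-reflected Gray code of length $m$; or - $M^2$-QAM, the Cartesian product of two such sets along the real and imaginary axes, with $\beta^2=3/(2(M^2-1))$, labelled by a pair of Gray words, one for each axis. (The binary-reflected Gray code of length $m+1$ is the code of length $m$ prefixed by $0$, followed by the code of length $m$ in reverse order prefixed by $1$.) The BICM capacity, in nats per channel use, is $$C(\mathrm{SNR})=\sum_i I(B_i;Y)=\sum_{i}\mathbb{E}\left[\log\frac{\sum_{x'\in\mathcal X^i_{B_i}}e^{-|H\sqrt{\mathrm{SNR}}(X-x')+Z|^2}}{\frac12\sum_{x'\in\mathcal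 X}e^{-|H\sqrt{\mathrm{SNR}}(X-x')+Z|^2}}\right],$$ where $i$ runs over the positions of the binary label, $B_i$ is the $i$-th bit of the label of $X$, and $\mathcal X^i_b$ is the set of symbols whose label has bit $b$ in position $i$. Then the first-order coefficient $c_1$ of the Taylor expansion of $C$ at $\mathrm{SNR}=0$ is $$c_1=\frac{3M^2}{4(M^2-1)},$$ that is, $C(\mathrm{SNR})=c_1\,\mathrm{SNR}+o(\mathrm{SNR})$ as $\mathrm{SNR}\to0$ and, if $\mathbb{E}[|H|^4]<\infty$, $C(\mathrm{SNR})=c_1\,\mathrm{SNR}+c_2\,\mathrm{SNR}^2+o(\mathrm{SNR}^2)$ for some real $c_2$. Hence the bit-energy-to-noise ratio at zero SNR, $\frac{E_b}{N_0}_{\lim}=\frac{\log 2}{c_1}$, which is the limit of $\frac{E_b}{N_0}=\frac{\mathrm{SNR}}{C(\mathrm{SNR})\log_2 e}$ as $\mathrm{SNR}\to0$, is $$\frac{E_b}{N_0}_{\lim}=\frac{4(M^2-1)}{3M^2}\log 2 .$$ As $M=2^m\to\infty$, $\frac{E_b}{N_0}_{\lim}$ is strictly increasing, stays below $\frac43\log2$,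 and converges to $\frac43\log 2$, which in decibels is $10\log_{10}\left(\frac43\log 2\right)\approx-0.3424$ (to within $5\cdot10^{-5}$). -/

import Mathlib

open Filter Topology MeasureTheory Asymptotics

noncomputable section

namespace BICM

/-! Channel `y = h * √SNR * x + z`, with the fading `h` known at the receiver. -/

/-- The conditional output density `p(y | x, h)` of the complex Gaussian channel. -/
def channelDensity (snr : ℝ) (x h y : ℂ) : ℝ :=
  1 / Real.pi * Real.exp (-‖y - h * (√snr : ℝ) * x‖ ^ 2)

/-- Law of the circularly symmetric complex Gaussian noise of unit variance. -/
def noiseLaw : Measure ℂ :=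
  volume.withDensity fun z => ENNReal.ofReal (1 / Real.pi * Real.exp (-‖z‖ ^ 2))

/-- The bit metric: the logarithm of
`(∑ x' ∈ X_b^i, p(y | x', h)) / ((1 / 2) * ∑ x' ∈ X, p(y | x', h))`.
The constellation is the family `x`, `label a` is the binary label of the symbol `x a`, and
`X_b^i` consists of the symbols whose label has the value `b` in position `i`. -/
def bitInfo {α ι : Type*} [Fintype α] (x : α → ℂ) (label : α → ι → Bool)
    (snr : ℝ) (i : ι) (b : Bool) (h y : ℂ) : ℝ :=
  Real.log ((∑ a' with label a' i = b, channelDensity snr (x a') h y) /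
    (1 / 2 * ∑ a', channelDensity snr (x a') h y))

/-- The BICM capacity in nats per channel use, `∑ i, I(B_i; Y)`: for each bit position, the
expected bit metric of the transmitted bit, over a uniformly distributed symbol,
the fading (with law `ν`) and the noise, all independent. -/
def bicmCapacity {α ι : Type*} [Fintype α] [Fintype ι] (ν : Measure ℂ)
    (x : α → ℂ) (label : α → ι → Bool) (snr : ℝ) : ℝ :=
  ∑ i, (1 / (Fintype.card α : ℝ)) * ∑ a,
    ∫ p : ℂ × ℂ, bitInfo x label snr i (label a i) p.1 (p.1 * (√snr : ℝ) * x a + p.2)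
      ∂(ν.prod noiseLaw)

/-- The `j`-th word of the binary-reflected Gray code of length `m` (`0 ≤ j < 2 ^ m`): the code of
length `m + 1` is the code of length `m` prefixed by `0`, followed by the code of length `m` in
reverse order prefixed by `1`. -/
def grayWord : (m : ℕ) → ℕ → Fin m → Bool
  | 0, _ => Fin.elim0
  | m + 1, j =>
      if j < 2 ^ m then Fin.cons false (grayWord m j)
      else Fin.cons true (grayWord m (2 ^ (m + 1) - 1 - j))

/-- The `j`-th level, in increasing order, of `{±1, ±3, …, ±(M - 1)}`, where `M = 2 ^ m`. -/
def level (m : ℕ) (j : Fin (2 ^ m)) : ℝ := 2 * (j : ℝ) + 1 - 2 ^ m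

/-- `M`-PAM of unit average energy, `M = 2 ^ m`. -/
def pam (m : ℕ) (j : Fin (2 ^ m)) : ℂ :=
  ((√(3 / ((2 ^ m : ℝ) ^ 2 - 1)) * level m j : ℝ) : ℂ)

/-- Gray labelling of `M`-PAM: successive points carry successive Gray words. -/
def pamLabel (m : ℕ) (j : Fin (2 ^ m)) : Fin m → Bool := grayWord m j

/-- `M²`-QAM of unit average energy, `M = 2 ^ m`: the Cartesian product of two `M`-PAM sets
along the real and imaginary axes. -/
def qam (m : ℕ) (p : Fin (2 ^ m) × Fin (2 ^ m)) : ℂ :=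
  ((√(3 / (2 * ((2 ^ m : ℝ) ^ 2 - 1))) : ℝ) : ℂ) *
    ((level m p.1 : ℂ) + (level m p.2 : ℂ) * Complex.I)

/-- Gray labelling of `M²`-QAM: one Gray word for each of the two axes. -/
def qamLabel (m : ℕ) (p : Fin (2 ^ m) × Fin (2 ^ m)) : Fin m ⊕ Fin m → Bool :=
  Sum.elim (grayWord m p.1) (grayWord m p.2)

/-- BICM capacity of `2 ^ m`-PAM with binary-reflected Gray mapping. -/
def pamCapacity (ν : Measure ℂ) (m : ℕ) : ℝ → ℝ := bicmCapacity ν (pam m) (pamLabel m)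

/-- BICM capacity of `(2 ^ m)²`-QAM with binary-reflected Gray mapping. -/
def qamCapacity (ν : Measure ℂ) (m : ℕ) : ℝ → ℝ := bicmCapacity ν (qam m) (qamLabel m)

/-- `C(SNR) = c₁ SNR + o(SNR)` as `SNR → 0`. -/
def HasFirstOrderExpansion (C : ℝ → ℝ) (c₁ : ℝ) : Prop :=
  (fun s => C s - c₁ * s) =o[𝓝[≥] 0] fun s : ℝ => s

/-- `C(SNR) = c₁ SNR + c₂ SNR² + o(SNR²)` as `SNR → 0`. -/
def HasSecondOrderExpansion (C : ℝ → ℝ) (c₁ c₂ : ℝ) : Prop :=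
  (fun s => C s - (c₁ * s + c₂ * s ^ 2)) =o[𝓝[≥] 0] fun s : ℝ => s ^ 2

/-- The first-order Taylor coefficient of the capacity at `SNR = 0`. -/
def firstOrderCoeff (C : ℝ → ℝ) : ℝ := derivWithin C (Set.Ici 0) 0

/-- The bit-energy-to-noise ratio `SNR / (C(SNR) log₂ e)`, in linear scale. -/
def ebN0 (C : ℝ → ℝ) (snr : ℝ) : ℝ := snr / (C snr * Real.logb 2 (Real.exp 1))

/-- The bit-energy-to-noise ratio at zero SNR, `log 2 / c₁`, in linear scale. -/
def ebN0Lim (C : ℝ → ℝ) : ℝ := Real.log 2 / firstOrderCoeff C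

/-- Conversion of a ratio from linear scale to decibels. -/
def dB (r : ℝ) : ℝ := 10 * Real.logb 10 r

end BICM

end

/-! Expanding the square in the Gaussian density, every exponent equals `-‖z‖ ^ 2` plus a quadratic
polynomial in `√s • w`, where `w = (‖h‖, h * conj z)`. The term `-‖z‖ ^ 2` cancels in the bit
metric, which becomes a difference of two functions `logMeanExp` at `√s • w` (`bitInfo_eq`). Each is
analytic with at most quadratic growth, so the Taylor remainder of order `n ≥ 2` is bounded globally
by `K * ‖w‖ ^ n`, and dominated convergence expands `𝔼[F (t W)]` to order `n` using only `n` moments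
of the fading. The symmetry `z ↦ -z` makes this function even in `t`; at `t = √s` only integer
powers of `s` remain.

The quadratic term of `logMeanExp` averages to `-‖mean of d‖ ^ 2`: the normalization of the Gaussian
cancels everything else (`integral_series_two_logMeanExp`). For a centred constellation of `N`
points with balanced bits, each bit thus contributes `4 / N ^ 2 * ‖T‖ ^ 2`, where `T` is the sum of
the symbols carrying a `0` (`sum_centred_halves`). Reflection of the Gray code preserves every bit
but the leading one and negates the levels, so `T = 0` except for the leading bit of each axis
(`sum_level_bitSet`). What remains is arithmetic in `M`. -/

noncomputable section

namespace BICM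

/-! ### Taylor expansion of averages under moment conditions -/

section Taylor

variable {E : Type*} [NormedAddCommGroup E]
variable {Ω : Type*} [MeasurableSpace Ω] {μ : Measure Ω} {W : Ω → E}

lemma integrable_norm_pow_of_le [IsFiniteMeasure μ] (hW : AEStronglyMeasurable W μ) {k n : ℕ}
    (hkn : k ≤ n) (hn : Integrable (fun ω => ‖W ω‖ ^ n) μ) :
    Integrable (fun ω => ‖W ω‖ ^ k) μ := by
  refine ((integrable_const (1 : ℝ)).add hn).mono' (hW.norm.pow k) (ae_of_all _ fun ω => ?_)
  simp only [Real.norm_eq_abs, abs_pow, abs_norm, Pi.add_apply]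
  rcases le_total ‖W ω‖ 1 with h | h
  · have := pow_le_one₀ (n := k) (norm_nonneg (W ω)) h
    have := pow_nonneg (norm_nonneg (W ω)) n
    linarith
  · have := pow_le_pow_right₀ h hkn
    linarith

lemma eq_zero_of_abs_le {F : E → ℝ} {C : ℝ} (hC : ∀ w, |F w| ≤ C * (‖w‖ + ‖w‖ ^ 2)) :
    F 0 = 0 := abs_nonpos_iff.1 (by simpa using hC 0)

variable [NormedSpace ℝ E]

lemma norm_series_apply_le (p : FormalMultilinearSeries ℝ E ℝ) (k : ℕ) (w : E) :
    |p k (fun _ => w)| ≤ ‖p k‖ * ‖w‖ ^ k := by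
  simpa using (p k).le_opNorm (fun _ => w)

lemma series_apply_smul (p : FormalMultilinearSeries ℝ E ℝ) (k : ℕ) (t : ℝ) (w : E) :
    p k (fun _ => t • w) = t ^ k * p k (fun _ => w) := by
  simpa using (p k).map_smul_univ (fun _ => t) (fun _ => w)

/-- A function of at most quadratic growth that is analytic at `0` satisfies a global
Taylor estimate of every order at least two. -/
lemma exists_forall_taylor_remainder_le {F : E → ℝ} {p : FormalMultilinearSeries ℝ E ℝ}
    (hF : HasFPowerSeriesAt F p 0) {C : ℝ} (hC : ∀ w, |F w| ≤ C * (‖w‖ + ‖w‖ ^ 2))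
    {n : ℕ} (hn : 2 ≤ n) :
    ∃ K, 0 ≤ K ∧ ∀ w, |F w - ∑ k ∈ Finset.range n, p k (fun _ => w)| ≤ K * ‖w‖ ^ n := by
  have h := (hF.isBigO_sub_partialSum_pow n).bound
  obtain ⟨c, hc⟩ := h
  obtain ⟨δ, hδ, hball⟩ := Metric.eventually_nhds_iff.1 hc
  -- Analyticity controls the remainder only on the ball of radius `δ`. Outside it, all lower powers
  -- are absorbed by `‖w‖ ^ n`; the growth bound contains `‖w‖ ^ 2`, whence `2 ≤ n`.
  have key : ∀ k ≤ n, ∀ w : E, δ ≤ ‖w‖ → ‖w‖ ^ k ≤ (δ ^ (n - k))⁻¹ * ‖w‖ ^ n := by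
    intro k hk w hw
    rw [← Nat.sub_add_cancel hk, pow_add]
    simp only [Nat.add_sub_cancel]
    rw [← mul_assoc]
    refine le_mul_of_one_le_left (by positivity) ?_
    rw [inv_mul_eq_div, one_le_div (by positivity)]
    gcongr
  have hC0 : ∀ w, |F w| ≤ |C| * (‖w‖ + ‖w‖ ^ 2) := fun w =>
    (hC w).trans (mul_le_mul_of_nonneg_right (le_abs_self C) (by positivity))
  set K₂ := |C| * ((δ ^ (n - 1))⁻¹ + (δ ^ (n - 2))⁻¹) +
    ∑ k ∈ Finset.range n, ‖p k‖ * (δ ^ (n - k))⁻¹ with hK₂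
  have hK₂0 : 0 ≤ K₂ := by positivity
  refine ⟨|c| + K₂, by positivity, fun w => ?_⟩
  rcases lt_or_ge ‖w‖ δ with hw | hw
  · have := hball (y := w) (by simpa using hw)
    simp only [zero_add, FormalMultilinearSeries.partialSum, Real.norm_eq_abs, abs_pow,
      abs_norm] at this
    calc _ ≤ c * ‖w‖ ^ n := this
      _ ≤ _ := by
        gcongr
        linarith [le_abs_self c]
  · calc |F w - ∑ k ∈ Finset.range n, p k (fun _ => w)|
        ≤ |F w| + |∑ k ∈ Finset.range n, p k (fun _ => w)| := abs_sub _ _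
      _ ≤ |C| * (‖w‖ + ‖w‖ ^ 2) + ∑ k ∈ Finset.range n, ‖p k‖ * ‖w‖ ^ k := by
        gcongr
        · exact hC0 w
        · exact (Finset.abs_sum_le_sum_abs _ _).trans
            (Finset.sum_le_sum fun k _ => norm_series_apply_le p k w)
      _ ≤ |C| * ((δ ^ (n - 1))⁻¹ * ‖w‖ ^ n + (δ ^ (n - 2))⁻¹ * ‖w‖ ^ n) +
          ∑ k ∈ Finset.range n, ‖p k‖ * ((δ ^ (n - k))⁻¹ * ‖w‖ ^ n) := by
        gcongr with k hk
        · simpa using key 1 (by omega) w hw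
        · exact key 2 hn w hw
        · exact key k (Finset.mem_range.1 hk).le w hw
      _ = K₂ * ‖w‖ ^ n := by
        rw [hK₂, add_mul, Finset.sum_mul]
        simp only [mul_assoc, add_mul]
      _ ≤ _ := by
        gcongr
        linarith [abs_nonneg c]

lemma integrable_series_apply [IsFiniteMeasure μ] (hW : AEStronglyMeasurable W μ) {k n : ℕ}
    (hkn : k ≤ n) (hn : Integrable (fun ω => ‖W ω‖ ^ n) μ)
    (p : FormalMultilinearSeries ℝ E ℝ) :
    Integrable (fun ω => p k (fun _ => W ω)) μ := by
  refine ((integrable_norm_pow_of_le hW hkn hn).const_mul ‖p k‖).mono' ?_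
    (ae_of_all _ fun ω => norm_series_apply_le p k (W ω))
  have hc : Continuous fun w : E => p k (fun _ => w) :=
    (p k).cont.comp (continuous_pi fun _ => continuous_id)
  exact hc.comp_aestronglyMeasurable hW

lemma integrable_comp_smul [IsFiniteMeasure μ] {F : E → ℝ} (hFc : Continuous F)
    {C : ℝ} (hC : ∀ w, |F w| ≤ C * (‖w‖ + ‖w‖ ^ 2))
    (hW : AEStronglyMeasurable W μ) (h2 : Integrable (fun ω => ‖W ω‖ ^ 2) μ) (t : ℝ) :
    Integrable (fun ω => F (t • W ω)) μ := by
  have h1 : Integrable (fun ω => ‖W ω‖) μ := by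
    simpa using integrable_norm_pow_of_le hW one_le_two h2
  refine (((h1.const_mul |t|).add (h2.const_mul (|t| ^ 2))).const_mul C).mono'
    (hFc.comp_aestronglyMeasurable (hW.const_smul t)) (ae_of_all _ fun ω => ?_)
  refine (hC _).trans (le_of_eq ?_)
  simp [norm_smul, mul_pow]

/-- Taylor expansion at `t = 0` of `t ↦ 𝔼[F (t W)]`, to the order of the moments of `W`. -/
lemma integral_comp_smul_isLittleO [IsFiniteMeasure μ] {F : E → ℝ} (hFc : Continuous F)
    {p : FormalMultilinearSeries ℝ E ℝ} (hF : HasFPowerSeriesAt F p 0)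
    {C : ℝ} (hC : ∀ w, |F w| ≤ C * (‖w‖ + ‖w‖ ^ 2))
    (hW : AEStronglyMeasurable W μ) {n : ℕ} (hn : 2 ≤ n)
    (hi : Integrable (fun ω => ‖W ω‖ ^ n) μ) :
    (fun t : ℝ => ∫ ω, F (t • W ω) ∂μ -
      ∑ k ∈ Finset.range (n + 1), t ^ k * ∫ ω, p k (fun _ => W ω) ∂μ)
      =o[𝓝 0] fun t : ℝ => t ^ n := by
  -- Two estimates for one remainder: order `n` gives an integrable dominating function, since only
  -- the `n`-th moment is available; order `n + 1` gives pointwise convergence of `R (t • W) / t ^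
  -- n` to `0`.
  obtain ⟨K, hK0, hK⟩ := exists_forall_taylor_remainder_le hF hC hn
  obtain ⟨K', hK0', hK'⟩ := exists_forall_taylor_remainder_le hF hC (n := n + 1) (by omega)
  set R : E → ℝ := fun w => F w - ∑ k ∈ Finset.range (n + 1), p k (fun _ => w) with hR
  have hRn : ∀ w, |R w| ≤ (K + ‖p n‖) * ‖w‖ ^ n := by
    intro w
    have : R w = (F w - ∑ k ∈ Finset.range n, p k (fun _ => w)) - p n (fun _ => w) := by
      simp only [hR, Finset.sum_range_succ]; ring
    rw [this, add_mul]
    exact (abs_sub _ _).trans (add_le_add (hK w) (norm_series_apply_le p n w))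
  have hRc : Continuous R := by
    refine hFc.sub (continuous_finsetSum _ fun k _ => ?_)
    exact (p k).cont.comp (continuous_pi fun _ => continuous_id)
  have h2 := integrable_norm_pow_of_le hW hn hi
  have hsplit : ∀ t : ℝ, ∫ ω, F (t • W ω) ∂μ -
      ∑ k ∈ Finset.range (n + 1), t ^ k * ∫ ω, p k (fun _ => W ω) ∂μ
      = ∫ ω, R (t • W ω) ∂μ := by
    intro t
    have hk : ∀ k ∈ Finset.range (n + 1),
        Integrable (fun ω => p k (fun _ => t • W ω)) μ := by
      intro k hk
      simp only [series_apply_smul]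
      exact (integrable_series_apply hW (by simpa [Nat.lt_succ_iff] using hk) hi p).const_mul _
    simp only [hR]
    rw [integral_sub (integrable_comp_smul hFc hC hW h2 t) (integrable_finsetSum _ hk),
      integral_finsetSum _ hk]
    simp only [series_apply_smul, integral_const_mul]
  simp only [hsplit]
  rw [isLittleO_iff_tendsto]
  · have hlim : Tendsto (fun t : ℝ => ∫ ω, R (t • W ω) / t ^ n ∂μ) (𝓝 0) (𝓝 (∫ _, (0 : ℝ) ∂μ)) := by
      refine tendsto_integral_filter_of_dominated_convergence
        (fun ω => (K + ‖p n‖) * ‖W ω‖ ^ n) ?_ ?_ (hi.const_mul _) ?_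
      · refine Eventually.of_forall fun t => ?_
        simp only [div_eq_mul_inv]
        exact (hRc.comp_aestronglyMeasurable (hW.const_smul t)).mul_const _
      · refine Eventually.of_forall fun t => ae_of_all _ fun ω => ?_
        rw [Real.norm_eq_abs, abs_div, abs_pow]
        refine div_le_of_le_mul₀ (by positivity) (by positivity) ((hRn _).trans (le_of_eq ?_))
        rw [norm_smul, mul_pow, Real.norm_eq_abs]; ring
      · refine ae_of_all _ fun ω => ?_
        refine squeeze_zero_norm (a := fun t : ℝ => K' * |t| * ‖W ω‖ ^ (n + 1)) (fun t => ?_) ?_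
        · rw [Real.norm_eq_abs, abs_div, abs_pow]
          refine div_le_of_le_mul₀ (by positivity) (by positivity) ((hK' _).trans (le_of_eq ?_))
          rw [norm_smul, mul_pow, Real.norm_eq_abs]; ring
        · have : Continuous fun t : ℝ => K' * |t| * ‖W ω‖ ^ (n + 1) := by fun_prop
          simpa using this.tendsto 0
    simpa [integral_div] using hlim
  · intro t ht
    have ht0 : t = 0 := by
      by_contra h
      exact pow_ne_zero n h ht
    have h0 : R 0 = 0 := by
      have := hRn 0
      rw [norm_zero, zero_pow (by omega), mul_zero] at this
      exact abs_nonpos_iff.1 this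
    simp [ht0, h0]

/-- If moreover `t ↦ 𝔼[F (t W)]` is even, only the even terms of the expansion remain. -/
lemma integral_comp_smul_isLittleO_of_even [IsFiniteMeasure μ] {F : E → ℝ} (hFc : Continuous F)
    {p : FormalMultilinearSeries ℝ E ℝ} (hF : HasFPowerSeriesAt F p 0)
    {C : ℝ} (hC : ∀ w, |F w| ≤ C * (‖w‖ + ‖w‖ ^ 2))
    (hW : AEStronglyMeasurable W μ) {n : ℕ} (hn : 2 ≤ n)
    (hi : Integrable (fun ω => ‖W ω‖ ^ n) μ)
    (heven : ∀ t : ℝ, ∫ ω, F (-t • W ω) ∂μ = ∫ ω, F (t • W ω) ∂μ) :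
    (fun t : ℝ => ∫ ω, F (t • W ω) ∂μ -
      ∑ k ∈ Finset.range (n + 1), (t ^ k + (-t) ^ k) / 2 * ∫ ω, p k (fun _ => W ω) ∂μ)
      =o[𝓝 0] fun t : ℝ => t ^ n := by
  have h1 := integral_comp_smul_isLittleO hFc hF hC hW hn hi
  have hneg : Tendsto (fun t : ℝ => -t) (𝓝 0) (𝓝 0) := by
    simpa using (continuous_neg (G := ℝ)).tendsto 0
  have h2 : (fun t : ℝ => ∫ ω, F (t • W ω) ∂μ -
      ∑ k ∈ Finset.range (n + 1), (-t) ^ k * ∫ ω, p k (fun _ => W ω) ∂μ)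
      =o[𝓝 0] fun t : ℝ => t ^ n := by
    have := h1.comp_tendsto hneg
    simp only [Function.comp_def, heven] at this
    refine this.trans_isBigO (IsBigO.of_bound 1 (Eventually.of_forall fun t => ?_))
    simp
  -- The expansions at `t` and `-t` describe the same function; averaging them cancels the odd
  -- terms.
  refine ((h1.add h2).const_mul_left (1 / 2)).congr_left fun t => ?_
  simp only [add_div, add_mul, Finset.sum_add_distrib]
  have : ∀ s : ℝ, ∑ k ∈ Finset.range (n + 1), s ^ k / 2 * ∫ ω, p k (fun _ => W ω) ∂μ =
      1 / 2 * ∑ k ∈ Finset.range (n + 1), s ^ k * ∫ ω, p k (fun _ => W ω) ∂μ := by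
    intro s
    rw [Finset.mul_sum]
    exact Finset.sum_congr rfl fun k _ => by ring
  rw [this, this]
  ring

lemma tendsto_sqrt_nhdsGE_zero : Tendsto (fun s : ℝ => √s) (𝓝[≥] 0) (𝓝 0) := by
  simpa using (Real.continuous_sqrt.tendsto 0).mono_left nhdsWithin_le_nhds

lemma hasFPowerSeriesAt_coeff_zero_eq_zero {F : E → ℝ} {p : FormalMultilinearSeries ℝ E ℝ}
    (hF : HasFPowerSeriesAt F p 0) (h0 : F 0 = 0) (v : Fin 0 → E) : p 0 v = 0 := by
  rw [hF.coeff_zero, h0]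

/-- Substituting `t = √s` turns the degree-two term into the term linear in `s`. Evenness removes
the `√s` term, and the growth bound forces `F 0 = 0`, hence no constant term. -/
lemma firstOrder_integral_comp_sqrt_smul [IsFiniteMeasure μ] {F : E → ℝ} (hFc : Continuous F)
    {p : FormalMultilinearSeries ℝ E ℝ} (hF : HasFPowerSeriesAt F p 0)
    {C : ℝ} (hC : ∀ w, |F w| ≤ C * (‖w‖ + ‖w‖ ^ 2))
    (hW : AEStronglyMeasurable W μ) (hi : Integrable (fun ω => ‖W ω‖ ^ 2) μ)
    (heven : ∀ t : ℝ, ∫ ω, F (-t • W ω) ∂μ = ∫ ω, F (t • W ω) ∂μ) :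
    HasFirstOrderExpansion (fun s => ∫ ω, F (√s • W ω) ∂μ) (∫ ω, p 2 (fun _ => W ω) ∂μ) := by
  have h := (integral_comp_smul_isLittleO_of_even hFc hF hC hW le_rfl hi heven).comp_tendsto
    tendsto_sqrt_nhdsGE_zero
  have hp0 := hasFPowerSeriesAt_coeff_zero_eq_zero hF (eq_zero_of_abs_le hC)
  refine h.congr' ?_ ?_
  · filter_upwards [self_mem_nhdsWithin] with s hs
    simp [Finset.sum_range_succ, hp0, Real.sq_sqrt hs]
    ring
  · filter_upwards [self_mem_nhdsWithin] with s hs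
    simp [Real.sq_sqrt hs]

lemma secondOrder_integral_comp_sqrt_smul [IsFiniteMeasure μ] {F : E → ℝ} (hFc : Continuous F)
    {p : FormalMultilinearSeries ℝ E ℝ} (hF : HasFPowerSeriesAt F p 0)
    {C : ℝ} (hC : ∀ w, |F w| ≤ C * (‖w‖ + ‖w‖ ^ 2))
    (hW : AEStronglyMeasurable W μ) (hi : Integrable (fun ω => ‖W ω‖ ^ 4) μ)
    (heven : ∀ t : ℝ, ∫ ω, F (-t • W ω) ∂μ = ∫ ω, F (t • W ω) ∂μ) :
    HasSecondOrderExpansion (fun s => ∫ ω, F (√s • W ω) ∂μ) (∫ ω, p 2 (fun _ => W ω) ∂μ)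
      (∫ ω, p 4 (fun _ => W ω) ∂μ) := by
  have h := (integral_comp_smul_isLittleO_of_even hFc hF hC hW (by norm_num) hi
    heven).comp_tendsto tendsto_sqrt_nhdsGE_zero
  have hp0 := hasFPowerSeriesAt_coeff_zero_eq_zero hF (eq_zero_of_abs_le hC)
  have h4 : ∀ s : ℝ, 0 ≤ s → √s ^ 4 = s ^ 2 := fun s hs => by
    rw [show √s ^ 4 = (√s ^ 2) ^ 2 by ring, Real.sq_sqrt hs]
  refine h.congr' ?_ ?_
  · filter_upwards [self_mem_nhdsWithin] with s hs
    have e3 : (-√s) ^ 3 = -√s ^ 3 := by ring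
    have e4 : (-√s) ^ 4 = √s ^ 4 := by ring
    simp [Finset.sum_range_succ, hp0, Real.sq_sqrt hs, e3, e4, h4 s hs]
    ring
  · filter_upwards [self_mem_nhdsWithin] with s hs
    simp [h4 s hs]

/-- Restricting to the line spanned by `w` and using uniqueness of one-variable power series reduces
the coefficient to a Taylor coefficient; the `2` is `2!`. -/
lemma series_two_apply_eq_iteratedDeriv {F : E → ℝ} {p : FormalMultilinearSeries ℝ E ℝ}
    (hF : HasFPowerSeriesAt F p 0) (w : E) :
    p 2 (fun _ => w) = iteratedDeriv 2 (fun t : ℝ => F (t • w)) 0 / 2 := by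
  set u : ℝ →L[ℝ] E := ContinuousLinearMap.toSpanSingleton ℝ w
  have hu : HasFPowerSeriesAt F p (u 0) := by simpa using hF
  have h1 := hu.compContinuousLinearMap
  have h2 := h1.analyticAt.hasFPowerSeriesAt
  have h3 := congrFun (h1.eq_formalMultilinearSeries h2) 2
  have h4 := congrArg (fun q => q (fun _ => (1 : ℝ))) h3
  have hcomp : (F ∘ u) = fun t : ℝ => F (t • w) := by
    ext t; simp [u]
  simp only [FormalMultilinearSeries.compContinuousLinearMap_apply, hcomp,
    FormalMultilinearSeries.ofScalars_apply_eq] at h4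
  have hu1 : (u ∘ fun _ : Fin 2 => (1 : ℝ)) = fun _ => w := by
    ext t; simp [u]
  rw [hu1] at h4
  simpa using h4

end Taylor

/-! ### Moments and circular symmetry of the Gaussian noise -/

section Noise

lemma integral_norm_rpow_noise (q : ℝ) (hq : -2 < q) :
    ∫ z : ℂ, ‖z‖ ^ q * (1 / Real.pi * Real.exp (-‖z‖ ^ 2)) = Real.Gamma ((q + 2) / 2) := by
  have h := Complex.integral_rpow_mul_exp_neg_rpow (p := 2) (q := q) (by norm_num) hq
  simp only [Real.rpow_two] at h
  have e : ∀ z : ℂ, ‖z‖ ^ q * (1 / Real.pi * Real.exp (-‖z‖ ^ 2)) =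
      1 / Real.pi * (‖z‖ ^ q * Real.exp (-‖z‖ ^ 2)) := fun z => by ring
  simp only [e, integral_const_mul, h]
  field_simp

/-- Without integrability the Bochner integral would be `0`, yet it is a positive Gamma value. -/
lemma integrable_norm_pow_noiseDensity (k : ℕ) :
    Integrable fun z : ℂ => ‖z‖ ^ k * (1 / Real.pi * Real.exp (-‖z‖ ^ 2)) := by
  by_contra h
  have h1 := integral_norm_rpow_noise k (by have := k.cast_nonneg (α := ℝ); linarith)
  simp only [Real.rpow_natCast] at h1
  rw [integral_undef h] at h1
  have := Real.Gamma_pos_of_pos (s := ((k : ℝ) + 2) / 2) (by positivity)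
  linarith

lemma measurable_noiseDensity :
    Measurable fun z : ℂ => (1 / Real.pi * Real.exp (-‖z‖ ^ 2)) := by fun_prop

lemma noiseDensity_nonneg (z : ℂ) : 0 ≤ 1 / Real.pi * Real.exp (-‖z‖ ^ 2) := by positivity

instance isProbabilityMeasure_noiseLaw : IsProbabilityMeasure noiseLaw := by
  constructor
  have h0 : Integrable fun z : ℂ => (1 / Real.pi * Real.exp (-‖z‖ ^ 2)) := by
    simpa using integrable_norm_pow_noiseDensity 0
  have h1 := integral_norm_rpow_noise 0 (by norm_num)
  simp only [Real.rpow_zero, one_mul] at h1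
  rw [noiseLaw, withDensity_apply _ MeasurableSet.univ, Measure.restrict_univ,
    ← ofReal_integral_eq_lintegral_ofReal h0 (ae_of_all _ noiseDensity_nonneg), h1]
  simp

lemma integral_noiseLaw (f : ℂ → ℝ) :
    ∫ z, f z ∂noiseLaw = ∫ z, (1 / Real.pi * Real.exp (-‖z‖ ^ 2)) * f z := by
  rw [noiseLaw, integral_withDensity_eq_integral_toReal_smul
    measurable_noiseDensity.ennreal_ofReal (ae_of_all _ fun _ => ENNReal.ofReal_lt_top)]
  refine integral_congr_ae (ae_of_all _ fun z => ?_)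
  simp only [ENNReal.toReal_ofReal (noiseDensity_nonneg z), smul_eq_mul]

lemma integrable_norm_pow_noiseLaw (k : ℕ) : Integrable (fun z : ℂ => ‖z‖ ^ k) noiseLaw := by
  rw [noiseLaw, integrable_withDensity_iff measurable_noiseDensity.ennreal_ofReal
    (ae_of_all _ fun _ => ENNReal.ofReal_lt_top)]
  refine (integrable_norm_pow_noiseDensity k).congr (ae_of_all _ fun z => ?_)
  simp only [ENNReal.toReal_ofReal (noiseDensity_nonneg z)]

lemma integral_norm_sq_noiseLaw : ∫ z, ‖z‖ ^ 2 ∂noiseLaw = 1 := by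
  have h := integral_norm_rpow_noise 2 (by norm_num)
  rw [show ((2 : ℝ) + 2) / 2 = 2 by norm_num, Real.Gamma_two] at h
  simp only [Real.rpow_two] at h
  rw [integral_noiseLaw]
  exact (integral_congr_ae (ae_of_all _ fun z => mul_comm _ _)).trans h

/-- The noise is circularly symmetric. -/
lemma measurePreserving_mul_noiseLaw (c : Circle) :
    MeasurePreserving (fun z : ℂ => (c : ℂ) * z) noiseLaw noiseLaw := by
  have hv : MeasurePreserving (fun z : ℂ => (c : ℂ) * z)
      (volume : Measure ℂ) (volume : Measure ℂ) := (rotation c).measurePreserving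
  refine ⟨hv.measurable, ?_⟩
  ext s hs
  rw [Measure.map_apply hv.measurable hs, noiseLaw, withDensity_apply _ hs,
    withDensity_apply _ (hv.measurable hs),
    ← hv.setLIntegral_comp_preimage hs measurable_noiseDensity.ennreal_ofReal]
  simp only [norm_mul, Circle.norm_coe, one_mul]

lemma integrable_of_abs_le_norm_sq {f : ℂ → ℝ} (hf : Continuous f) (h : ∀ z, |f z| ≤ ‖z‖ ^ 2) :
    Integrable f noiseLaw :=
  (integrable_norm_pow_noiseLaw 2).mono' hf.aestronglyMeasurable (ae_of_all _ h)

lemma integrable_re_sq_noiseLaw : Integrable (fun z : ℂ => z.re ^ 2) noiseLaw :=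
  integrable_of_abs_le_norm_sq (by fun_prop) fun z => by
    rw [abs_pow]; gcongr; exact Complex.abs_re_le_norm z

lemma integrable_im_sq_noiseLaw : Integrable (fun z : ℂ => z.im ^ 2) noiseLaw :=
  integrable_of_abs_le_norm_sq (by fun_prop) fun z => by
    rw [abs_pow]; gcongr; exact Complex.abs_im_le_norm z

lemma integrable_re_mul_im_noiseLaw : Integrable (fun z : ℂ => z.re * z.im) noiseLaw :=
  integrable_of_abs_le_norm_sq (by fun_prop) fun z => by
    rw [abs_mul, sq]
    exact mul_le_mul (Complex.abs_re_le_norm z) (Complex.abs_im_le_norm z)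
      (abs_nonneg _) (norm_nonneg _)

lemma integral_comp_I_mul_noiseLaw (f : ℂ → ℝ) (hf : Measurable f) :
    ∫ z, f (Complex.I * z) ∂noiseLaw = ∫ z, f z ∂noiseLaw := by
  have h := measurePreserving_mul_noiseLaw ⟨Complex.I, by simp [Submonoid.unitSphere]⟩
  have h2 := integral_map (μ := noiseLaw) h.measurable.aemeasurable
    (f := f) hf.aestronglyMeasurable
  rw [h.map_eq] at h2
  exact h2.symm

/-- Rotation by `I` exchanges the two second moments, and they add up to one. -/
lemma integral_re_sq_noiseLaw : ∫ z : ℂ, z.re ^ 2 ∂noiseLaw = 1 / 2 ∧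
    ∫ z : ℂ, z.im ^ 2 ∂noiseLaw = 1 / 2 := by
  have h1 := integral_comp_I_mul_noiseLaw (fun z => z.re ^ 2) (by fun_prop)
  have h2 := integral_norm_sq_noiseLaw
  have e : ∀ z : ℂ, ‖z‖ ^ 2 = z.re ^ 2 + z.im ^ 2 := fun z => by
    rw [Complex.sq_norm, Complex.normSq_apply]; ring
  simp only [e] at h2
  rw [integral_add integrable_re_sq_noiseLaw integrable_im_sq_noiseLaw] at h2
  simp at h1
  constructor <;> linarith

/-- Rotation by `I` changes the sign of the integrand. -/
lemma integral_re_mul_im_noiseLaw : ∫ z : ℂ, z.re * z.im ∂noiseLaw = 0 := by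
  have h1 := integral_comp_I_mul_noiseLaw (fun z => z.re * z.im) (by fun_prop)
  simp only [Complex.I_mul_re, Complex.I_mul_im, neg_mul, integral_neg] at h1
  have : ∀ z : ℂ, z.im * z.re = z.re * z.im := fun z => mul_comm _ _
  simp only [this] at h1
  linarith

lemma re_mul_sq (z c : ℂ) : (z * c).re ^ 2 =
    c.re ^ 2 * z.re ^ 2 + c.im ^ 2 * z.im ^ 2 - 2 * c.re * c.im * (z.re * z.im) := by
  rw [Complex.mul_re]; ring

lemma integral_re_mul_sq_noiseLaw (c : ℂ) :
    ∫ z : ℂ, (z * c).re ^ 2 ∂noiseLaw = ‖c‖ ^ 2 / 2 := by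
  simp only [re_mul_sq]
  have h := (integrable_re_sq_noiseLaw.const_mul (c.re ^ 2)).add
    (integrable_im_sq_noiseLaw.const_mul (c.im ^ 2))
  simp only [Pi.add_def] at h
  rw [integral_sub h (integrable_re_mul_im_noiseLaw.const_mul _),
    integral_add (integrable_re_sq_noiseLaw.const_mul _) (integrable_im_sq_noiseLaw.const_mul _)]
  simp only [integral_const_mul, integral_re_sq_noiseLaw.1, integral_re_sq_noiseLaw.2,
    integral_re_mul_im_noiseLaw]
  rw [Complex.sq_norm, Complex.normSq_apply]; ring

end Noise

/-! ### Logarithm of an average of exponentials -/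

section LogMeanExp

open scoped ContDiff

variable {α : Type*}

/-- Up to the term `-‖z‖ ^ 2`, the exponent `-‖√s * h * d + z‖ ^ 2` of the channel density,
at `w = √s • (‖h‖, h * conj z)`. -/
def exponent (w : ℝ × ℂ) (d : ℂ) : ℝ := -(w.1 ^ 2 * ‖d‖ ^ 2) - 2 * (w.2 * d).re

/-- The logarithm of the average over `S` of the normalized channel densities. -/
def logMeanExp (S : Finset α) (d : α → ℂ) (w : ℝ × ℂ) : ℝ :=
  Real.log ((∑ a ∈ S, Real.exp (exponent w (d a))) / S.card)

lemma exponent_smul (t : ℝ) (w : ℝ × ℂ) (d : ℂ) :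
    exponent (t • w) d = t * (-2 * (w.2 * d).re) + t ^ 2 * -(w.1 ^ 2 * ‖d‖ ^ 2) := by
  simp [exponent]
  ring

lemma contDiff_exponent (d : ℂ) : ContDiff ℝ ω fun w : ℝ × ℂ => exponent w d := by
  unfold exponent
  have : ContDiff ℝ ω fun w : ℝ × ℂ => (w.2 * d).re :=
    Complex.reCLM.contDiff.comp (contDiff_snd.mul contDiff_const)
  exact ((contDiff_fst.pow 2).mul contDiff_const).neg.sub (contDiff_const.mul this)

lemma sum_exp_pos {S : Finset α} (hS : S.Nonempty) (f : α → ℝ) :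
    0 < ∑ a ∈ S, Real.exp (f a) := Finset.sum_pos (fun _ _ => Real.exp_pos _) hS

lemma contDiff_logMeanExp {S : Finset α} (hS : S.Nonempty) (d : α → ℂ) :
    ContDiff ℝ ω (logMeanExp S d) := by
  unfold logMeanExp
  refine ContDiff.log ((ContDiff.sum fun a _ => (contDiff_exponent (d a)).exp).div_const _)
    fun w => ?_
  have h1 := sum_exp_pos hS fun a => exponent w (d a)
  have h2 : (0 : ℝ) < S.card := by exact_mod_cast hS.card_pos
  positivity

lemma abs_exponent_le (w : ℝ × ℂ) (d : ℂ) :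
    |exponent w d| ≤ (‖d‖ ^ 2 + 2 * ‖d‖) * (‖w‖ + ‖w‖ ^ 2) := by
  have h1 : |w.1| ≤ ‖w‖ := norm_fst_le w
  have h2 : ‖w.2‖ ≤ ‖w‖ := norm_snd_le w
  have h3 : |(w.2 * d).re| ≤ ‖w‖ * ‖d‖ := by
    refine (Complex.abs_re_le_norm _).trans ?_
    rw [norm_mul]
    gcongr
  have h4 : w.1 ^ 2 ≤ ‖w‖ ^ 2 := by
    rw [← sq_abs]
    gcongr
  calc |exponent w d| ≤ |-(w.1 ^ 2 * ‖d‖ ^ 2)| + |2 * (w.2 * d).re| := abs_sub _ _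
    _ = w.1 ^ 2 * ‖d‖ ^ 2 + 2 * |(w.2 * d).re| := by
      rw [abs_neg, abs_of_nonneg (by positivity : 0 ≤ w.1 ^ 2 * ‖d‖ ^ 2), abs_mul]; norm_num
    _ ≤ ‖w‖ ^ 2 * ‖d‖ ^ 2 + 2 * (‖w‖ * ‖d‖) := by gcongr
    _ ≤ _ := by
      have := norm_nonneg w
      have := norm_nonneg d
      nlinarith [mul_nonneg (norm_nonneg w) (sq_nonneg ‖d‖),
        mul_nonneg (sq_nonneg ‖w‖) (norm_nonneg d)]

/-- A mean of exponentials lies between the extreme exponentials, so the growth of `logMeanExp` is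
that of the exponents. -/
lemma abs_log_mean_exp_le {S : Finset α} (hS : S.Nonempty) {f : α → ℝ} {c : ℝ}
    (hf : ∀ a ∈ S, |f a| ≤ c) : |Real.log ((∑ a ∈ S, Real.exp (f a)) / S.card)| ≤ c := by
  have h0 : (0 : ℝ) < S.card := by exact_mod_cast hS.card_pos
  have hpos := sum_exp_pos hS f
  rw [abs_le]
  constructor
  · rw [Real.le_log_iff_exp_le (by positivity), le_div_iff₀ h0, mul_comm, ← nsmul_eq_mul]
    exact Finset.card_nsmul_le_sum _ _ _ fun a ha =>
      Real.exp_le_exp.2 (abs_le.1 (hf a ha)).1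
  · rw [Real.log_le_iff_le_exp (by positivity), div_le_iff₀ h0, mul_comm, ← nsmul_eq_mul]
    exact Finset.sum_le_card_nsmul _ _ _ fun a ha =>
      Real.exp_le_exp.2 (abs_le.1 (hf a ha)).2

lemma abs_logMeanExp_le {S : Finset α} (hS : S.Nonempty) (d : α → ℂ) (w : ℝ × ℂ) :
    |logMeanExp S d w| ≤ (∑ a ∈ S, (‖d a‖ ^ 2 + 2 * ‖d a‖)) * (‖w‖ + ‖w‖ ^ 2) := by
  refine abs_log_mean_exp_le hS fun a ha => (abs_exponent_le w (d a)).trans ?_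
  gcongr
  exact Finset.single_le_sum (f := fun a => ‖d a‖ ^ 2 + 2 * ‖d a‖)
    (fun a _ => by positivity) ha

/-- The second cumulant: the logarithmic derivative is a quotient in which the cardinality cancels,
and at `0` its denominator equals the cardinality. -/
lemma iteratedDeriv_two_log_mean_exp {S : Finset α} (hS : S.Nonempty) (A B : α → ℝ) :
    iteratedDeriv 2 (fun t : ℝ =>
        Real.log ((∑ a ∈ S, Real.exp (t * A a + t ^ 2 * B a)) / S.card)) 0 =
      (∑ a ∈ S, (A a ^ 2 + 2 * B a)) / S.card - ((∑ a ∈ S, A a) / S.card) ^ 2 := by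
  have h0 : (S.card : ℝ) ≠ 0 := by exact_mod_cast hS.card_pos.ne'
  have he : ∀ a (t : ℝ), HasDerivAt (fun t : ℝ => Real.exp (t * A a + t ^ 2 * B a))
      (Real.exp (t * A a + t ^ 2 * B a) * (A a + 2 * t * B a)) t := fun a t => by
    have := (((hasDerivAt_id t).mul_const (A a)).add
      (((hasDerivAt_id t).pow 2).mul_const (B a))).exp
    simpa using this
  have hs : ∀ t : ℝ, HasDerivAt (fun t : ℝ => ∑ a ∈ S, Real.exp (t * A a + t ^ 2 * B a))
      (∑ a ∈ S, Real.exp (t * A a + t ^ 2 * B a) * (A a + 2 * t * B a)) t := fun t =>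
    HasDerivAt.fun_sum fun a _ => he a t
  have hs' : HasDerivAt
      (fun t : ℝ => ∑ a ∈ S, Real.exp (t * A a + t ^ 2 * B a) * (A a + 2 * t * B a))
      (∑ a ∈ S, (A a ^ 2 + 2 * B a)) 0 := by
    refine HasDerivAt.fun_sum fun a _ => ?_
    have h1 : HasDerivAt (fun t : ℝ => A a + 2 * t * B a) (2 * B a) 0 := by
      simpa using (((hasDerivAt_id (0 : ℝ)).const_mul 2).mul_const (B a)).const_add (A a)
    refine ((he a 0).mul h1).congr_deriv ?_
    simp
    ring
  have hd : deriv (fun t : ℝ =>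
      Real.log ((∑ a ∈ S, Real.exp (t * A a + t ^ 2 * B a)) / S.card)) = fun t =>
      (∑ a ∈ S, Real.exp (t * A a + t ^ 2 * B a) * (A a + 2 * t * B a)) /
        ∑ a ∈ S, Real.exp (t * A a + t ^ 2 * B a) := by
    ext t
    have hp := (sum_exp_pos hS fun a => t * A a + t ^ 2 * B a).ne'
    rw [(((hs t).div_const _).log (div_ne_zero hp h0)).deriv, div_div_div_cancel_right₀ h0]
  rw [iteratedDeriv_succ, iteratedDeriv_one, hd]
  have hp := (sum_exp_pos hS fun a => 0 * A a + 0 ^ 2 * B a).ne'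
  rw [(hs'.fun_div (hs 0) hp).deriv]
  simp
  field_simp

end LogMeanExp

/-! ### Averaging over fading and noise -/

section Fading

variable {α : Type*} {ν : Measure ℂ}

/-- The pair `(‖h‖, h * conj z)` through which fading and noise enter the bit metric. -/
def fadedNoise (p : ℂ × ℂ) : ℝ × ℂ := (‖p.1‖, p.1 * (starRingEnd ℂ) p.2)

lemma continuous_fadedNoise : Continuous fadedNoise := by
  unfold fadedNoise
  fun_prop

lemma norm_fadedNoise_le (p : ℂ × ℂ) : ‖fadedNoise p‖ ≤ ‖p.1‖ * (1 + ‖p.2‖) := by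
  rw [fadedNoise, Prod.norm_mk, norm_norm, norm_mul, RCLike.norm_conj]
  refine max_le ?_ ?_ <;> nlinarith [norm_nonneg p.1, norm_nonneg p.2]

lemma integrable_one_add_norm_pow_noiseLaw (n : ℕ) :
    Integrable (fun z : ℂ => (1 + ‖z‖) ^ n) noiseLaw := by
  have e : ∀ z : ℂ, (1 + ‖z‖) ^ n = ∑ k ∈ Finset.range (n + 1), ‖z‖ ^ (n - k) * n.choose k := by
    intro z
    simp [add_pow]
  simp only [e]
  exact integrable_finsetSum _ fun k _ => (integrable_norm_pow_noiseLaw _).mul_const _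

/-- The norm is at most `‖h‖ * (1 + ‖z‖)`, a product of independent factors, and the Gaussian factor
has all moments: only the fading limits the order. -/
lemma integrable_norm_fadedNoise_pow [IsProbabilityMeasure ν] {n : ℕ}
    (h : Integrable (fun h : ℂ => ‖h‖ ^ n) ν) :
    Integrable (fun p => ‖fadedNoise p‖ ^ n) (ν.prod noiseLaw) := by
  refine (h.mul_prod (integrable_one_add_norm_pow_noiseLaw n)).mono'
    (continuous_fadedNoise.norm.pow n).aestronglyMeasurable (ae_of_all _ fun p => ?_)
  rw [Real.norm_eq_abs, abs_pow, abs_norm, ← mul_pow]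
  exact pow_le_pow_left₀ (norm_nonneg _) (norm_fadedNoise_le p) n

/-- The first coordinate enters only squared, so changing the sign of `t` amounts to changing that
of the noise, whose law is symmetric. This is the source of evenness. -/
lemma logMeanExp_neg_smul_fadedNoise (S : Finset α) (d : α → ℂ) (t : ℝ) (p : ℂ × ℂ) :
    logMeanExp S d (-t • fadedNoise p) = logMeanExp S d (t • fadedNoise (p.1, -p.2)) := by
  simp [logMeanExp, exponent, fadedNoise]

lemma measurePreserving_neg_noise [IsProbabilityMeasure ν] :
    MeasurePreserving (fun p : ℂ × ℂ => (p.1, -p.2)) (ν.prod noiseLaw) (ν.prod noiseLaw) := by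
  have h := measurePreserving_mul_noiseLaw (-1)
  simp only [Circle.coe_neg, Circle.coe_one, neg_one_mul] at h
  exact (MeasurePreserving.id ν).prod h

lemma integral_logMeanExp_neg_smul [IsProbabilityMeasure ν] {S : Finset α} (hS : S.Nonempty)
    (d : α → ℂ) (t : ℝ) :
    ∫ p, logMeanExp S d (-t • fadedNoise p) ∂(ν.prod noiseLaw) =
      ∫ p, logMeanExp S d (t • fadedNoise p) ∂(ν.prod noiseLaw) := by
  have hc : Continuous fun p => logMeanExp S d (t • fadedNoise p) :=
    (contDiff_logMeanExp hS d).continuous.comp (continuous_fadedNoise.const_smul t)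
  have h := integral_map (μ := ν.prod noiseLaw)
    (measurePreserving_neg_noise (ν := ν)).measurable.aemeasurable
    (f := fun p => logMeanExp S d (t • fadedNoise p)) hc.aestronglyMeasurable
  rw [(measurePreserving_neg_noise (ν := ν)).map_eq] at h
  rw [h]
  exact integral_congr_ae (ae_of_all _ fun p => logMeanExp_neg_smul_fadedNoise S d t p)

lemma integrable_norm_sq_of_integral_eq_one (hν : ∫ h, ‖h‖ ^ 2 ∂ν = 1) :
    Integrable (fun h : ℂ => ‖h‖ ^ 2) ν := by
  by_contra h
  rw [integral_undef h] at hν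
  exact zero_ne_one hν

lemma integrable_re_fadedNoise_mul_sq [IsProbabilityMeasure ν] (hν : ∫ h, ‖h‖ ^ 2 ∂ν = 1)
    (c : ℂ) :
    Integrable (fun p => ((fadedNoise p).2 * c).re ^ 2) (ν.prod noiseLaw) := by
  have h2 := integrable_norm_fadedNoise_pow (integrable_norm_sq_of_integral_eq_one hν)
  refine (h2.mul_const (‖c‖ ^ 2)).mono' (Continuous.aestronglyMeasurable ?_)
    (ae_of_all _ fun p => ?_)
  · have := continuous_fadedNoise
    fun_prop
  · rw [Real.norm_eq_abs, abs_pow, ← mul_pow]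
    gcongr
    refine (Complex.abs_re_le_norm _).trans ?_
    rw [norm_mul]
    gcongr
    exact norm_snd_le _

/-- For fixed `h`, conjugation moves `h * c` onto one side and the noise integral is `‖h * c‖ ^ 2 /
2`; the fading then has unit energy. -/
lemma integral_re_fadedNoise_mul_sq [IsProbabilityMeasure ν] (hν : ∫ h, ‖h‖ ^ 2 ∂ν = 1)
    (c : ℂ) :
    ∫ p, ((fadedNoise p).2 * c).re ^ 2 ∂(ν.prod noiseLaw) = ‖c‖ ^ 2 / 2 := by
  rw [integral_prod _ (integrable_re_fadedNoise_mul_sq hν c)]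
  have e : ∀ h z : ℂ, ((fadedNoise (h, z)).2 * c).re ^ 2 =
      (z * (starRingEnd ℂ) (h * c)).re ^ 2 := by
    intro h z
    rw [← Complex.conj_re]
    congr 2
    simp [fadedNoise]
    ring
  simp only [e, integral_re_mul_sq_noiseLaw, RCLike.norm_conj, norm_mul, mul_pow, mul_div_assoc,
    integral_mul_const, hν, one_mul]

lemma integral_norm_sq_fst [IsProbabilityMeasure ν] (hν : ∫ h, ‖h‖ ^ 2 ∂ν = 1) :
    ∫ p : ℂ × ℂ, ‖p.1‖ ^ 2 ∂(ν.prod noiseLaw) = 1 := by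
  rw [integral_fun_fst (μ := ν) (ν := noiseLaw) (fun h => ‖h‖ ^ 2)]
  simp [hν]

/-- The second-order term of the averaged log-likelihood. -/
lemma integral_series_two_logMeanExp [IsProbabilityMeasure ν] (hν : ∫ h, ‖h‖ ^ 2 ∂ν = 1)
    {S : Finset α} (hS : S.Nonempty) (d : α → ℂ)
    {q : FormalMultilinearSeries ℝ (ℝ × ℂ) ℝ} (hq : HasFPowerSeriesAt (logMeanExp S d) q 0) :
    ∫ p, q 2 (fun _ => fadedNoise p) ∂(ν.prod noiseLaw) =
      -‖(∑ a ∈ S, d a) / (S.card : ℂ)‖ ^ 2 := by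
  set c : ℂ := (∑ a ∈ S, d a) / (S.card : ℂ) with hc
  have h0 : (S.card : ℝ) ≠ 0 := by exact_mod_cast hS.card_pos.ne'
  have e : ∀ p, q 2 (fun _ => fadedNoise p) =
      (∑ a ∈ S, (2 * ((fadedNoise p).2 * d a).re ^ 2 - ‖p.1‖ ^ 2 * ‖d a‖ ^ 2)) / S.card -
        2 * ((fadedNoise p).2 * c).re ^ 2 := by
    intro p
    rw [series_two_apply_eq_iteratedDeriv hq]
    simp only [logMeanExp, exponent_smul]
    rw [iteratedDeriv_two_log_mean_exp hS]
    have hm : (∑ a ∈ S, -2 * ((fadedNoise p).2 * d a).re) / (S.card : ℝ) =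
        -2 * ((fadedNoise p).2 * c).re := by
      rw [hc, ← Finset.mul_sum, ← Complex.re_sum, ← Finset.mul_sum, ← mul_div_assoc,
        ← Complex.ofReal_natCast, Complex.div_ofReal_re, mul_div_assoc]
    have hs : ∑ a ∈ S, ((-2 * ((fadedNoise p).2 * d a).re) ^ 2 +
        2 * -((fadedNoise p).1 ^ 2 * ‖d a‖ ^ 2)) =
        2 * ∑ a ∈ S, (2 * ((fadedNoise p).2 * d a).re ^ 2 - ‖p.1‖ ^ 2 * ‖d a‖ ^ 2) := by
      rw [Finset.mul_sum]
      refine Finset.sum_congr rfl fun a _ => ?_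
      simp only [fadedNoise]
      ring
    rw [hm, hs]
    ring
  have hi1 : Integrable (fun p : ℂ × ℂ => ‖p.1‖ ^ 2) (ν.prod noiseLaw) :=
    (integrable_norm_sq_of_integral_eq_one hν).comp_fst _
  have hi2 := fun c => (integrable_re_fadedNoise_mul_sq (ν := ν) hν c).const_mul 2
  have hi3 : ∀ a ∈ S, Integrable (fun p : ℂ × ℂ =>
      2 * ((fadedNoise p).2 * d a).re ^ 2 - ‖p.1‖ ^ 2 * ‖d a‖ ^ 2) (ν.prod noiseLaw) :=
    fun a _ => (hi2 (d a)).sub (hi1.mul_const _)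
  simp only [e]
  rw [integral_sub ((integrable_finsetSum _ hi3).div_const _) (hi2 c), integral_div,
    integral_finsetSum _ hi3]
  -- The noise cross term and the energy term of each symbol cancel on average, leaving only the
  -- square of the mean.
  have hz : ∀ a ∈ S, ∫ p : ℂ × ℂ, (2 * ((fadedNoise p).2 * d a).re ^ 2 - ‖p.1‖ ^ 2 * ‖d a‖ ^ 2)
      ∂(ν.prod noiseLaw) = 0 := by
    intro a _
    rw [integral_sub (hi2 _) (hi1.mul_const _), integral_const_mul, integral_mul_const,
      integral_re_fadedNoise_mul_sq hν, integral_norm_sq_fst hν]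
    ring
  rw [Finset.sum_congr rfl hz, integral_const_mul, integral_re_fadedNoise_mul_sq hν,
    Finset.sum_const_zero]
  ring

lemma firstOrder_integral_logMeanExp [IsProbabilityMeasure ν] (hν : ∫ h, ‖h‖ ^ 2 ∂ν = 1)
    {S : Finset α} (hS : S.Nonempty) (d : α → ℂ) :
    HasFirstOrderExpansion
      (fun s => ∫ p, logMeanExp S d (√s • fadedNoise p) ∂(ν.prod noiseLaw))
      (-‖(∑ a ∈ S, d a) / (S.card : ℂ)‖ ^ 2) := by
  obtain ⟨q, hq⟩ := (contDiff_logMeanExp hS d).contDiffAt.analyticAt (x := 0)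
  rw [← integral_series_two_logMeanExp hν hS d hq]
  exact firstOrder_integral_comp_sqrt_smul (contDiff_logMeanExp hS d).continuous hq
    (abs_logMeanExp_le hS d) continuous_fadedNoise.aestronglyMeasurable
    (integrable_norm_fadedNoise_pow (integrable_norm_sq_of_integral_eq_one hν))
    (integral_logMeanExp_neg_smul hS d)

lemma secondOrder_integral_logMeanExp [IsProbabilityMeasure ν] (hν : ∫ h, ‖h‖ ^ 2 ∂ν = 1)
    (h4 : Integrable (fun h : ℂ => ‖h‖ ^ 4) ν) {S : Finset α} (hS : S.Nonempty) (d : α → ℂ) :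
    ∃ c₂, HasSecondOrderExpansion
      (fun s => ∫ p, logMeanExp S d (√s • fadedNoise p) ∂(ν.prod noiseLaw))
      (-‖(∑ a ∈ S, d a) / (S.card : ℂ)‖ ^ 2) c₂ := by
  obtain ⟨q, hq⟩ := (contDiff_logMeanExp hS d).contDiffAt.analyticAt (x := 0)
  rw [← integral_series_two_logMeanExp hν hS d hq]
  exact ⟨_, secondOrder_integral_comp_sqrt_smul (contDiff_logMeanExp hS d).continuous hq
    (abs_logMeanExp_le hS d) continuous_fadedNoise.aestronglyMeasurable
    (integrable_norm_fadedNoise_pow h4) (integral_logMeanExp_neg_smul hS d)⟩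

lemma integrable_logMeanExp [IsProbabilityMeasure ν] (hν : ∫ h, ‖h‖ ^ 2 ∂ν = 1)
    {S : Finset α} (hS : S.Nonempty) (d : α → ℂ) (t : ℝ) :
    Integrable (fun p => logMeanExp S d (t • fadedNoise p)) (ν.prod noiseLaw) :=
  integrable_comp_smul (contDiff_logMeanExp hS d).continuous (abs_logMeanExp_le hS d)
    continuous_fadedNoise.aestronglyMeasurable
    (integrable_norm_fadedNoise_pow (integrable_norm_sq_of_integral_eq_one hν)) t

end Fading

/-! ### Algebra of expansions at zero SNR -/

section Expansion

lemma HasFirstOrderExpansion.const_mul {C : ℝ → ℝ} {c : ℝ} (h : HasFirstOrderExpansion C c)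
    (k : ℝ) : HasFirstOrderExpansion (fun s => k * C s) (k * c) :=
  (h.const_mul_left k).congr_left fun s => by ring

lemma HasFirstOrderExpansion.sub {C C' : ℝ → ℝ} {c c' : ℝ} (h : HasFirstOrderExpansion C c)
    (h' : HasFirstOrderExpansion C' c') :
    HasFirstOrderExpansion (fun s => C s - C' s) (c - c') :=
  (IsLittleO.sub h h').congr_left fun s => by ring

lemma HasFirstOrderExpansion.sum {κ : Type*} {S : Finset κ} {C : κ → ℝ → ℝ} {c : κ → ℝ}
    (h : ∀ i ∈ S, HasFirstOrderExpansion (C i) (c i)) :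
    HasFirstOrderExpansion (fun s => ∑ i ∈ S, C i s) (∑ i ∈ S, c i) :=
  (IsLittleO.sum h).congr_left fun s => by
    simp only [Finset.sum_apply, Finset.sum_sub_distrib, Finset.sum_mul]

lemma HasFirstOrderExpansion.congr {C C' : ℝ → ℝ} {c : ℝ} (h : HasFirstOrderExpansion C c)
    (he : ∀ s, 0 ≤ s → C s = C' s) : HasFirstOrderExpansion C' c :=
  h.congr' (by filter_upwards [self_mem_nhdsWithin] with s hs; rw [he s hs]) EventuallyEq.rfl

lemma HasSecondOrderExpansion.const_mul {C : ℝ → ℝ} {c e : ℝ}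
    (h : HasSecondOrderExpansion C c e) (k : ℝ) :
    HasSecondOrderExpansion (fun s => k * C s) (k * c) (k * e) :=
  (h.const_mul_left k).congr_left fun s => by ring

lemma HasSecondOrderExpansion.sub {C C' : ℝ → ℝ} {c c' e e' : ℝ}
    (h : HasSecondOrderExpansion C c e) (h' : HasSecondOrderExpansion C' c' e') :
    HasSecondOrderExpansion (fun s => C s - C' s) (c - c') (e - e') :=
  (IsLittleO.sub h h').congr_left fun s => by ring

lemma HasSecondOrderExpansion.sum {κ : Type*} {S : Finset κ} {C : κ → ℝ → ℝ} {c e : κ → ℝ}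
    (h : ∀ i ∈ S, HasSecondOrderExpansion (C i) (c i) (e i)) :
    HasSecondOrderExpansion (fun s => ∑ i ∈ S, C i s) (∑ i ∈ S, c i) (∑ i ∈ S, e i) :=
  (IsLittleO.sum h).congr_left fun s => by
    simp only [Finset.sum_apply, Finset.sum_sub_distrib, Finset.sum_add_distrib, Finset.sum_mul]

lemma HasSecondOrderExpansion.congr {C C' : ℝ → ℝ} {c e : ℝ}
    (h : HasSecondOrderExpansion C c e) (he : ∀ s, 0 ≤ s → C s = C' s) :
    HasSecondOrderExpansion C' c e :=
  h.congr' (by filter_upwards [self_mem_nhdsWithin] with s hs; rw [he s hs]) EventuallyEq.rfl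

end Expansion

/-! ### Capacity of a centred constellation with balanced labels -/

section Capacity

lemma average_sub_eq {α : Type*} {S : Finset α} (hS : S.Nonempty) (u : ℂ) (x : α → ℂ) :
    (∑ a ∈ S, (u - x a)) / (S.card : ℂ) = u - (∑ a ∈ S, x a) / (S.card : ℂ) := by
  have : (S.card : ℂ) ≠ 0 := by exact_mod_cast hS.card_pos.ne'
  rw [Finset.sum_sub_distrib, Finset.sum_const, nsmul_eq_mul]
  field_simp

variable {α ι : Type*} [Fintype α] {ν : Measure ℂ}

/-- The symbols whose label has the value `b` in position `i`. -/
def bitSet (label : α → ι → Bool) (i : ι) (b : Bool) : Finset α :=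
  Finset.univ.filter fun a => label a i = b

lemma mem_bitSet {label : α → ι → Bool} {i : ι} {b : Bool} {a : α} :
    a ∈ bitSet label i b ↔ label a i = b := by
  simp [bitSet]

lemma bitSet_nonempty [Nonempty α] {label : α → ι → Bool} {i : ι} {b : Bool}
    (h : 2 * (bitSet label i b).card = Fintype.card α) : (bitSet label i b).Nonempty := by
  rw [← Finset.card_pos]
  have := Fintype.card_pos (α := α)
  omega

lemma channelDensity_eq (s : ℝ) (u v h z : ℂ) :
    channelDensity s v h (h * (√s : ℝ) * u + z) =
      1 / Real.pi * Real.exp (-‖z‖ ^ 2) *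
        Real.exp (exponent (√s • fadedNoise (h, z)) (u - v)) := by
  rw [channelDensity, mul_assoc (1 / Real.pi), ← Real.exp_add]
  congr 2
  have e : h * (√s : ℝ) * u + z - h * (√s : ℝ) * v = (√s : ℝ) * (h * (u - v)) + z := by ring
  have e2 : ((√s : ℝ) * (h * (u - v)) * (starRingEnd ℂ) z).re =
      √s * (h * (starRingEnd ℂ) z * (u - v)).re := by
    rw [← Complex.re_ofReal_mul]
    congr 1
    ring
  rw [e, exponent_smul, Complex.sq_norm (_ + _), Complex.normSq_add, e2]
  simp only [fadedNoise, Complex.normSq_mul, Complex.normSq_ofReal, Complex.sq_norm]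
  ring

/-- Balance of the bit lets the factor `1 / 2` turn the ratio of sums into a ratio of averages; the
common factor `1 / π * exp (-‖z‖ ^ 2)` cancels. -/
lemma bitInfo_eq [Nonempty α] (x : α → ℂ) {label : α → ι → Bool} {i : ι} {b : Bool}
    (hb : 2 * (bitSet label i b).card = Fintype.card α) (s : ℝ) (h u z : ℂ) :
    bitInfo x label s i b h (h * (√s : ℝ) * u + z) =
      logMeanExp (bitSet label i b) (fun a' => u - x a') (√s • fadedNoise (h, z)) -
        logMeanExp Finset.univ (fun a' => u - x a') (√s • fadedNoise (h, z)) := by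
  have hS := bitSet_nonempty hb
  have hc : (0 : ℝ) < (bitSet label i b).card := by exact_mod_cast hS.card_pos
  have hα : (0 : ℝ) < Fintype.card α := by exact_mod_cast Fintype.card_pos
  have h2 : 2 * ((bitSet label i b).card : ℝ) = Fintype.card α := by exact_mod_cast hb
  set f := fun a' => exponent (√s • fadedNoise (h, z)) (u - x a')
  have hp1 := sum_exp_pos hS f
  have hp2 := sum_exp_pos Finset.univ_nonempty f
  have hk : (0 : ℝ) < 1 / Real.pi * Real.exp (-‖z‖ ^ 2) := by positivity
  simp only [bitInfo, logMeanExp, channelDensity_eq, ← Finset.mul_sum]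
  change Real.log (_ * (∑ a' ∈ bitSet label i b, Real.exp (f a')) / (1 / 2 * (_ *
    ∑ a', Real.exp (f a')))) = Real.log ((∑ a' ∈ bitSet label i b, Real.exp (f a')) / _) -
      Real.log ((∑ a', Real.exp (f a')) / _)
  rw [← Real.log_div (by positivity) (by rw [Finset.card_univ]; positivity), Finset.card_univ,
    ← h2]
  congr 1
  field_simp

lemma bicmCapacity_eq [Nonempty α] [Fintype ι] [IsProbabilityMeasure ν]
    (hν : ∫ h, ‖h‖ ^ 2 ∂ν = 1) (x : α → ℂ) {label : α → ι → Bool}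
    (hb : ∀ i b, 2 * (bitSet label i b).card = Fintype.card α) (s : ℝ) :
    bicmCapacity ν x label s = ∑ i, (1 / (Fintype.card α : ℝ)) * ∑ a,
      (∫ p, logMeanExp (bitSet label i (label a i)) (fun a' => x a - x a') (√s • fadedNoise p)
          ∂(ν.prod noiseLaw) -
        ∫ p, logMeanExp Finset.univ (fun a' => x a - x a') (√s • fadedNoise p)
          ∂(ν.prod noiseLaw)) := by
  unfold bicmCapacity
  refine Finset.sum_congr rfl fun i _ => ?_
  congr 1
  refine Finset.sum_congr rfl fun a _ => ?_
  rw [← integral_sub (integrable_logMeanExp hν (bitSet_nonempty (hb i _)) _ _)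
    (integrable_logMeanExp hν Finset.univ_nonempty _ _)]
  exact integral_congr_ae (ae_of_all _ fun p => bitInfo_eq x (hb i _) s p.1 (x a) p.2)

/-- For a centred constellation split into two halves, the average squared distance to the
mean of the half that contains the symbol. -/
lemma sum_centred_halves [Nonempty α] {x : α → ℂ} (hx : ∑ a, x a = 0) {label : α → ι → Bool}
    {i : ι} (hb : ∀ b, 2 * (bitSet label i b).card = Fintype.card α) :
    1 / (Fintype.card α : ℝ) * ∑ a,
      (-‖(∑ a' ∈ bitSet label i (label a i), (x a - x a')) /
          ((bitSet label i (label a i)).card : ℂ)‖ ^ 2 -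
        -‖(∑ a', (x a - x a')) / ((Finset.univ : Finset α).card : ℂ)‖ ^ 2) =
      4 / (Fintype.card α : ℝ) ^ 2 * ‖∑ a ∈ bitSet label i false, x a‖ ^ 2 := by
  set N : ℝ := (Fintype.card α : ℝ) with hN
  have hN0 : 0 < N := by rw [hN]; exact_mod_cast Fintype.card_pos
  set T : Bool → ℂ := fun b => ∑ a ∈ bitSet label i b, x a with hT
  have hcard : ∀ b, ((bitSet label i b).card : ℝ) = N / 2 := fun b => by
    have : 2 * ((bitSet label i b).card : ℝ) = N := by rw [hN]; exact_mod_cast hb b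
    linarith
  have hcardC : ∀ b, ((bitSet label i b).card : ℂ) = ((N / 2 : ℝ) : ℂ) := fun b => by
    rw [← hcard b]; simp
  have hsplit : ∀ f : α → ℝ, ∑ a, f a = ∑ b, ∑ a ∈ bitSet label i b, f a := fun f =>
    (Finset.sum_fiberwise Finset.univ (fun a => label a i) f).symm
  -- Centring makes the two halves opposite, so both contribute equally.
  have hTsum : T true = -T false := by
    have := Finset.sum_fiberwise Finset.univ (fun a => label a i) x
    rw [hx, Fintype.sum_bool] at this
    exact eq_neg_of_add_eq_zero_left this
  have hhalf : ∀ b, ∑ a ∈ bitSet label i b,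
      (-‖(∑ a' ∈ bitSet label i (label a i), (x a - x a')) /
          ((bitSet label i (label a i)).card : ℂ)‖ ^ 2 -
        -‖(∑ a', (x a - x a')) / ((Finset.univ : Finset α).card : ℂ)‖ ^ 2) =
      2 / N * ‖T b‖ ^ 2 := by
    -- With `μ` the mean of the half, the cross terms sum to `N * ‖μ‖ ^ 2` and the squares to `N / 2
    -- * ‖μ‖ ^ 2`; the difference is `2 / N * ‖T b‖ ^ 2`.
    intro b
    set μ : ℂ := T b / ((N / 2 : ℝ) : ℂ) with hμ
    have h1 : ∀ a ∈ bitSet label i b,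
        (-‖(∑ a' ∈ bitSet label i (label a i), (x a - x a')) /
            ((bitSet label i (label a i)).card : ℂ)‖ ^ 2 -
          -‖(∑ a', (x a - x a')) / ((Finset.univ : Finset α).card : ℂ)‖ ^ 2) =
        2 * (x a * (starRingEnd ℂ) μ).re - ‖μ‖ ^ 2 := by
      intro a ha
      have hab : label a i = b := mem_bitSet.1 ha
      rw [hab, average_sub_eq (bitSet_nonempty (hb b)), average_sub_eq Finset.univ_nonempty, hx,
        hcardC, zero_div, sub_zero]
      change -‖x a - μ‖ ^ 2 - -‖x a‖ ^ 2 = _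
      rw [Complex.sq_norm, Complex.normSq_sub, Complex.sq_norm, Complex.sq_norm]
      ring
    rw [Finset.sum_congr rfl h1, Finset.sum_sub_distrib, ← Finset.mul_sum, ← Complex.re_sum,
      ← Finset.sum_mul, Finset.sum_const, nsmul_eq_mul, hcard]
    change 2 * (T b * (starRingEnd ℂ) μ).re - N / 2 * ‖μ‖ ^ 2 = _
    rw [hμ, map_div₀, Complex.conj_ofReal, ← mul_div_assoc, Complex.mul_conj,
      ← Complex.ofReal_div, Complex.ofReal_re, norm_div, Complex.norm_real, Real.norm_eq_abs,
      abs_of_pos (by positivity), ← Complex.sq_norm]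
    field_simp
    ring
  rw [hsplit, Fintype.sum_bool, hhalf, hhalf, hTsum, norm_neg]
  field_simp
  ring

variable [Nonempty α] [Fintype ι] [IsProbabilityMeasure ν]

/-- First-order expansion of the BICM capacity of a centred constellation with balanced labels. -/
lemma firstOrder_bicmCapacity (hν : ∫ h, ‖h‖ ^ 2 ∂ν = 1) {x : α → ℂ} (hx : ∑ a, x a = 0)
    {label : α → ι → Bool} (hb : ∀ i b, 2 * (bitSet label i b).card = Fintype.card α) :
    HasFirstOrderExpansion (bicmCapacity ν x label)
      (∑ i, 4 / (Fintype.card α : ℝ) ^ 2 * ‖∑ a ∈ bitSet label i false, x a‖ ^ 2) := by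
  refine HasFirstOrderExpansion.congr ?_ fun s _ => (bicmCapacity_eq hν x hb s).symm
  refine HasFirstOrderExpansion.sum fun i _ => ?_
  rw [← sum_centred_halves hx (hb i)]
  refine (HasFirstOrderExpansion.sum fun a _ => ?_).const_mul _
  exact (firstOrder_integral_logMeanExp hν (bitSet_nonempty (hb i _)) _).sub
    (firstOrder_integral_logMeanExp hν Finset.univ_nonempty _)

lemma secondOrder_bicmCapacity (hν : ∫ h, ‖h‖ ^ 2 ∂ν = 1)
    (h4 : Integrable (fun h : ℂ => ‖h‖ ^ 4) ν) {x : α → ℂ} (hx : ∑ a, x a = 0)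
    {label : α → ι → Bool} (hb : ∀ i b, 2 * (bitSet label i b).card = Fintype.card α) :
    ∃ c₂, HasSecondOrderExpansion (bicmCapacity ν x label)
      (∑ i, 4 / (Fintype.card α : ℝ) ^ 2 * ‖∑ a ∈ bitSet label i false, x a‖ ^ 2) c₂ := by
  choose e he using fun (i : ι) (a : α) =>
    secondOrder_integral_logMeanExp hν h4 (bitSet_nonempty (hb i (label a i)))
      (fun a' => x a - x a')
  choose e' he' using fun (a : α) =>
    secondOrder_integral_logMeanExp hν h4 (Finset.univ_nonempty (α := α)) (fun a' => x a - x a')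
  refine ⟨∑ i, 1 / (Fintype.card α : ℝ) * ∑ a, (e i a - e' a), ?_⟩
  refine HasSecondOrderExpansion.congr ?_ fun s _ => (bicmCapacity_eq hν x hb s).symm
  refine HasSecondOrderExpansion.sum fun i _ => ?_
  rw [← sum_centred_halves hx (hb i)]
  exact (HasSecondOrderExpansion.sum fun a _ => (he i a).sub (he' a)).const_mul _

end Capacity

/-! ### Reflection symmetry of the Gray code -/

section Gray

lemma grayWord_succ_of_lt {m j : ℕ} (hj : j < 2 ^ m) :
    grayWord (m + 1) j = Fin.cons false (grayWord m j) := by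
  simp [grayWord, hj]

lemma grayWord_succ_reflect {m j : ℕ} (hj : j < 2 ^ m) :
    grayWord (m + 1) (2 ^ (m + 1) - 1 - j) = Fin.cons true (grayWord m j) := by
  have h1 : ¬ 2 ^ (m + 1) - 1 - j < 2 ^ m := by rw [pow_succ]; omega
  have h2 : 2 ^ (m + 1) - 1 - (2 ^ (m + 1) - 1 - j) = j := by rw [pow_succ]; omega
  rw [grayWord, if_neg h1, h2]

/-- Pairing each index with its mirror image adapts sums to the reflected code. -/
lemma sum_fin_two_pow_succ {β : Type*} [AddCommMonoid β] (m : ℕ) (f : ℕ → β) :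
    ∑ j : Fin (2 ^ (m + 1)), f j = ∑ j : Fin (2 ^ m), (f j + f (2 ^ (m + 1) - 1 - j)) := by
  rw [Fin.sum_univ_eq_sum_range, Fin.sum_univ_eq_sum_range
    (fun j => f j + f (2 ^ (m + 1) - 1 - j)), Finset.sum_add_distrib, pow_succ, mul_two,
    Finset.sum_range_add, ← Finset.sum_range_reflect (fun j => f (2 ^ m + j))]
  congr 1
  refine Finset.sum_congr rfl fun j hj => ?_
  rw [Finset.mem_range] at hj
  congr 1
  omega

/-- Mirrored words differ in the leading bit, so each pair contributes one; they agree in every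
other bit, so the count for length `m` doubles. -/
lemma card_bitSet_pamLabel (m : ℕ) (i : Fin m) (b : Bool) :
    2 * (bitSet (pamLabel m) i b).card = 2 ^ m := by
  have hcard : ∀ m i, (bitSet (pamLabel m) i b).card =
      ∑ j : Fin (2 ^ m), if grayWord m (j : ℕ) i = b then 1 else 0 := fun m i => by
    rw [bitSet, Finset.card_filter]
    rfl
  induction m with
  | zero => exact i.elim0
  | succ m ih =>
    rw [hcard, sum_fin_two_pow_succ m fun j => if grayWord (m + 1) j i = b then 1 else 0]
    refine Fin.cases ?_ (fun i => ?_) i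
    · have : ∀ j : Fin (2 ^ m), ((if grayWord (m + 1) (j : ℕ) 0 = b then 1 else 0) +
          if grayWord (m + 1) (2 ^ (m + 1) - 1 - (j : ℕ)) 0 = b then 1 else 0) = 1 := by
        intro j
        rw [grayWord_succ_of_lt j.2, grayWord_succ_reflect j.2]
        cases b <;> simp
      rw [Finset.sum_congr rfl fun j _ => this j]
      simp [pow_succ]
      ring
    · have : ∀ j : Fin (2 ^ m), ((if grayWord (m + 1) (j : ℕ) i.succ = b then 1 else 0) +
          if grayWord (m + 1) (2 ^ (m + 1) - 1 - (j : ℕ)) i.succ = b then 1 else 0) =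
          2 * if grayWord m (j : ℕ) i = b then 1 else 0 := by
        intro j
        rw [grayWord_succ_of_lt j.2, grayWord_succ_reflect j.2, Fin.cons_succ, Fin.cons_succ]
        ring
      rw [Finset.sum_congr rfl fun j _ => this j, ← Finset.mul_sum, ← hcard, ih, pow_succ]
      ring

lemma level_add_reflect {m j : ℕ} (hj : j < 2 ^ m) :
    (2 * (j : ℝ) + 1 - 2 ^ (m + 1)) + (2 * ((2 ^ (m + 1) - 1 - j : ℕ) : ℝ) + 1 - 2 ^ (m + 1)) =
      0 := by
  have h : 2 ^ (m + 1) - 1 - j + (1 + j) = 2 ^ (m + 1) := by rw [pow_succ]; omega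
  have h' : ((2 ^ (m + 1) - 1 - j : ℕ) : ℝ) + (1 + j) = 2 ^ (m + 1) := by exact_mod_cast h
  linarith

lemma sum_fin_two_mul_add_one_sub (n : ℕ) (c : ℝ) :
    ∑ j : Fin n, (2 * (j : ℝ) + 1 - c) = n * (n - c) := by
  rw [Fin.sum_univ_eq_sum_range (fun j => 2 * (j : ℝ) + 1 - c)]
  induction n with
  | zero => simp
  | succ n ih => rw [Finset.sum_range_succ, ih]; push_cast; ring

lemma sum_level (m : ℕ) : ∑ j, level m j = 0 := by
  simp only [level]
  rw [sum_fin_two_mul_add_one_sub]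
  simp

/-- Only the most significant bit of the Gray label is biased. -/
lemma sum_level_bitSet (m : ℕ) (i : Fin (m + 1)) :
    ∑ j ∈ bitSet (pamLabel (m + 1)) i false, level (m + 1) j =
      if i = 0 then -((2 : ℝ) ^ m) ^ 2 else 0 := by
  have hsum : ∑ j ∈ bitSet (pamLabel (m + 1)) i false, level (m + 1) j =
      ∑ j : Fin (2 ^ (m + 1)), if grayWord (m + 1) (j : ℕ) i = false then
        2 * ((j : ℕ) : ℝ) + 1 - 2 ^ (m + 1) else 0 := by
    rw [bitSet, Finset.sum_filter]
    rfl
  rw [hsum, sum_fin_two_pow_succ m fun j => if grayWord (m + 1) j i = false then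
    2 * (j : ℝ) + 1 - 2 ^ (m + 1) else 0]
  refine Fin.cases ?_ (fun i => ?_) i
  -- The leading bit selects the lower half, whose levels sum to `2 ^ m * (2 ^ m - 2 ^ (m + 1))`.
  · have : ∀ j : Fin (2 ^ m), ((if grayWord (m + 1) (j : ℕ) 0 = false then
        2 * ((j : ℕ) : ℝ) + 1 - 2 ^ (m + 1) else 0) +
        if grayWord (m + 1) (2 ^ (m + 1) - 1 - (j : ℕ)) 0 = false then
          2 * ((2 ^ (m + 1) - 1 - (j : ℕ) : ℕ) : ℝ) + 1 - 2 ^ (m + 1) else 0) =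
        2 * ((j : ℕ) : ℝ) + 1 - 2 ^ (m + 1) := by
      intro j
      rw [grayWord_succ_of_lt j.2, grayWord_succ_reflect j.2]
      simp
    rw [Finset.sum_congr rfl fun j _ => this j, sum_fin_two_mul_add_one_sub, if_pos rfl]
    push_cast
    ring
  · rw [if_neg (Fin.succ_ne_zero i)]
    -- Mirrored points share this bit and have opposite levels.
    refine Finset.sum_eq_zero fun j _ => ?_
    rw [grayWord_succ_of_lt j.2, grayWord_succ_reflect j.2, Fin.cons_succ, Fin.cons_succ]
    split_ifs
    · exact level_add_reflect j.2
    · simp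

end Gray

/-! ### First-order coefficients of PAM and QAM -/

section Constellation

lemma sum_pam (m : ℕ) : ∑ j, pam m j = 0 := by
  simp only [pam]
  rw [← Complex.ofReal_sum, ← Finset.mul_sum, sum_level]
  simp

lemma four_pow_sub_one_pos (m : ℕ) : 0 < ((2 : ℝ) ^ (m + 1)) ^ 2 - 1 := by
  have : (1 : ℝ) < 2 ^ (m + 1) := one_lt_pow₀ (by norm_num) (by omega)
  nlinarith

/-- Only the leading bit counts: `4 / M ^ 2 * (3 / (M ^ 2 - 1)) * (M ^ 2 / 4) ^ 2`. -/
lemma firstOrderSum_pam (m : ℕ) :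
    ∑ i, 4 / (Fintype.card (Fin (2 ^ (m + 1))) : ℝ) ^ 2 *
      ‖∑ a ∈ bitSet (pamLabel (m + 1)) i false, pam (m + 1) a‖ ^ 2 =
      3 * ((2 : ℝ) ^ (m + 1)) ^ 2 / (4 * (((2 : ℝ) ^ (m + 1)) ^ 2 - 1)) := by
  have hpos := four_pow_sub_one_pos m
  have h : ∀ i, ∑ a ∈ bitSet (pamLabel (m + 1)) i false, pam (m + 1) a =
      ((√(3 / (((2 : ℝ) ^ (m + 1)) ^ 2 - 1)) *
        if i = 0 then -((2 : ℝ) ^ m) ^ 2 else 0 : ℝ) : ℂ) := by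
    intro i
    simp only [pam]
    rw [← Complex.ofReal_sum, ← Finset.mul_sum, sum_level_bitSet]
  simp only [h, Complex.norm_real, Real.norm_eq_abs, sq_abs, Fintype.card_fin]
  rw [Fin.sum_univ_succ, Finset.sum_eq_zero fun i _ => by simp, if_pos rfl, mul_pow,
    Real.sq_sqrt (by positivity)]
  push_cast
  rw [pow_succ] at hpos ⊢
  field_simp
  ring

lemma bitSet_qamLabel_inl (m : ℕ) (i : Fin m) (b : Bool) :
    bitSet (qamLabel m) (Sum.inl i) b = bitSet (pamLabel m) i b ×ˢ Finset.univ := by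
  ext p
  simp [mem_bitSet, qamLabel, pamLabel]

lemma bitSet_qamLabel_inr (m : ℕ) (i : Fin m) (b : Bool) :
    bitSet (qamLabel m) (Sum.inr i) b = Finset.univ ×ˢ bitSet (pamLabel m) i b := by
  ext p
  simp [mem_bitSet, qamLabel, pamLabel]

lemma card_bitSet_qamLabel (m : ℕ) (i : Fin m ⊕ Fin m) (b : Bool) :
    2 * (bitSet (qamLabel m) i b).card = Fintype.card (Fin (2 ^ m) × Fin (2 ^ m)) := by
  rcases i with i | i
  · rw [bitSet_qamLabel_inl, Finset.card_product, ← mul_assoc, card_bitSet_pamLabel]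
    simp
  · rw [bitSet_qamLabel_inr, Finset.card_product, mul_left_comm, card_bitSet_pamLabel]
    simp

lemma sum_product_qam (m : ℕ) (A B : Finset (Fin (2 ^ m))) :
    ∑ p ∈ A ×ˢ B, qam m p = ((√(3 / (2 * ((2 ^ m : ℝ) ^ 2 - 1))) : ℝ) : ℂ) *
      (((B.card * ∑ j ∈ A, level m j : ℝ) : ℂ) +
        ((A.card * ∑ j ∈ B, level m j : ℝ) : ℂ) * Complex.I) := by
  simp only [qam]
  rw [← Finset.mul_sum, Finset.sum_product]
  congr 1
  simp only [Finset.sum_add_distrib, Finset.sum_const, nsmul_eq_mul, ← Finset.sum_mul]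
  push_cast
  rw [← Finset.mul_sum]
  ring

lemma sum_qam (m : ℕ) : ∑ p, qam m p = 0 := by
  rw [← Finset.univ_product_univ, sum_product_qam, sum_level]
  simp

/-- Each axis contributes `4 / M ^ 4 * (3 / (2 * (M ^ 2 - 1))) * (M * (M ^ 2 / 4)) ^ 2`, half of the
PAM value; the factor `M` counts the points along the other axis. -/
lemma firstOrderSum_qam (m : ℕ) :
    ∑ i, 4 / (Fintype.card (Fin (2 ^ (m + 1)) × Fin (2 ^ (m + 1))) : ℝ) ^ 2 *
      ‖∑ a ∈ bitSet (qamLabel (m + 1)) i false, qam (m + 1) a‖ ^ 2 =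
      3 * ((2 : ℝ) ^ (m + 1)) ^ 2 / (4 * (((2 : ℝ) ^ (m + 1)) ^ 2 - 1)) := by
  have hpos := four_pow_sub_one_pos m
  have h1 : ∀ i, ‖∑ a ∈ bitSet (qamLabel (m + 1)) (Sum.inl i) false, qam (m + 1) a‖ ^ 2 =
      3 / (2 * (((2 : ℝ) ^ (m + 1)) ^ 2 - 1)) *
        (2 ^ (m + 1) * if i = 0 then -((2 : ℝ) ^ m) ^ 2 else 0) ^ 2 := by
    intro i
    rw [bitSet_qamLabel_inl, sum_product_qam, sum_level_bitSet, sum_level, mul_zero,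
      Complex.ofReal_zero, zero_mul, add_zero, ← Complex.ofReal_mul, Complex.norm_real,
      Real.norm_eq_abs, sq_abs, mul_pow, Real.sq_sqrt (by positivity)]
    simp
  have h2 : ∀ i, ‖∑ a ∈ bitSet (qamLabel (m + 1)) (Sum.inr i) false, qam (m + 1) a‖ ^ 2 =
      3 / (2 * (((2 : ℝ) ^ (m + 1)) ^ 2 - 1)) *
        (2 ^ (m + 1) * if i = 0 then -((2 : ℝ) ^ m) ^ 2 else 0) ^ 2 := by
    intro i
    rw [bitSet_qamLabel_inr, sum_product_qam, sum_level_bitSet, sum_level, mul_zero,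
      Complex.ofReal_zero, zero_add, norm_mul, norm_mul, Complex.norm_I, mul_one,
      ← norm_mul, ← Complex.ofReal_mul, Complex.norm_real,
      Real.norm_eq_abs, sq_abs, mul_pow, Real.sq_sqrt (by positivity)]
    simp
  simp only [Fintype.sum_sum_type, h1, h2, Fintype.card_prod, Fintype.card_fin]
  rw [Fin.sum_univ_succ, Finset.sum_eq_zero fun i _ => by simp, if_pos rfl]
  push_cast
  rw [pow_succ] at hpos ⊢
  field_simp
  ring

variable {ν : Measure ℂ} [IsProbabilityMeasure ν]

lemma firstOrder_pamCapacity (hν : ∫ h, ‖h‖ ^ 2 ∂ν = 1) (m : ℕ) :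
    HasFirstOrderExpansion (pamCapacity ν (m + 1))
      (3 * ((2 : ℝ) ^ (m + 1)) ^ 2 / (4 * (((2 : ℝ) ^ (m + 1)) ^ 2 - 1))) := by
  rw [← firstOrderSum_pam]
  exact firstOrder_bicmCapacity hν (sum_pam _) fun i b => by
    rw [card_bitSet_pamLabel, Fintype.card_fin]

lemma secondOrder_pamCapacity (hν : ∫ h, ‖h‖ ^ 2 ∂ν = 1)
    (h4 : Integrable (fun h : ℂ => ‖h‖ ^ 4) ν) (m : ℕ) :
    ∃ c₂, HasSecondOrderExpansion (pamCapacity ν (m + 1))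
      (3 * ((2 : ℝ) ^ (m + 1)) ^ 2 / (4 * (((2 : ℝ) ^ (m + 1)) ^ 2 - 1))) c₂ := by
  rw [← firstOrderSum_pam]
  exact secondOrder_bicmCapacity hν h4 (sum_pam _) fun i b => by
    rw [card_bitSet_pamLabel, Fintype.card_fin]

lemma firstOrder_qamCapacity (hν : ∫ h, ‖h‖ ^ 2 ∂ν = 1) (m : ℕ) :
    HasFirstOrderExpansion (qamCapacity ν (m + 1))
      (3 * ((2 : ℝ) ^ (m + 1)) ^ 2 / (4 * (((2 : ℝ) ^ (m + 1)) ^ 2 - 1))) := by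
  rw [← firstOrderSum_qam]
  exact firstOrder_bicmCapacity hν (sum_qam _) (card_bitSet_qamLabel _)

lemma secondOrder_qamCapacity (hν : ∫ h, ‖h‖ ^ 2 ∂ν = 1)
    (h4 : Integrable (fun h : ℂ => ‖h‖ ^ 4) ν) (m : ℕ) :
    ∃ c₂, HasSecondOrderExpansion (qamCapacity ν (m + 1))
      (3 * ((2 : ℝ) ^ (m + 1)) ^ 2 / (4 * (((2 : ℝ) ^ (m + 1)) ^ 2 - 1))) c₂ := by
  rw [← firstOrderSum_qam]
  exact secondOrder_bicmCapacity hν h4 (sum_qam _) (card_bitSet_qamLabel _)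

end Constellation

/-! ### Bit energy at zero SNR and its limit -/

section ZeroSNR

lemma HasFirstOrderExpansion.hasDerivWithinAt {C : ℝ → ℝ} {c : ℝ}
    (h : HasFirstOrderExpansion C c) : HasDerivWithinAt C c (Set.Ici 0) 0 := by
  -- The filter `𝓝[≥] 0` includes the point `0`, where the little-o bound forces the value to
  -- vanish.
  have h0 : C 0 = 0 := by
    have := h.bound one_pos
    have := this.self_of_nhdsWithin (Set.self_mem_Ici (a := (0 : ℝ)))
    simpa using this
  rw [hasDerivWithinAt_iff_isLittleO, h0]
  exact IsLittleO.congr h (fun s => by simp [mul_comm]) fun s => by simp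

lemma HasFirstOrderExpansion.firstOrderCoeff_eq {C : ℝ → ℝ} {c : ℝ}
    (h : HasFirstOrderExpansion C c) : firstOrderCoeff C = c :=
  h.hasDerivWithinAt.derivWithin (uniqueDiffWithinAt_Ici 0)

/-- Since `log₂ e = 1 / log 2`, the ratio is `log 2` times the inverse of `C s / s`, which tends to
`c`. -/
lemma HasFirstOrderExpansion.tendsto_ebN0 {C : ℝ → ℝ} {c : ℝ}
    (h : HasFirstOrderExpansion C c) (hc : c ≠ 0) :
    Tendsto (ebN0 C) (𝓝[>] 0) (𝓝 (ebN0Lim C)) := by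
  have h1 : Tendsto (fun s => (C s - c * s) / s) (𝓝[>] 0) (𝓝 0) :=
    (h.mono (nhdsWithin_mono 0 Set.Ioi_subset_Ici_self)).tendsto_div_nhds_zero
  have h2 : Tendsto (fun s => C s / s) (𝓝[>] 0) (𝓝 c) := by
    have := h1.add_const c
    rw [zero_add] at this
    refine this.congr' ?_
    filter_upwards [self_mem_nhdsWithin] with s hs
    have : s ≠ 0 := (Set.mem_Ioi.1 hs).ne'
    field_simp
    ring
  rw [ebN0Lim, h.firstOrderCoeff_eq]
  refine (h2.inv₀ hc |>.const_mul (Real.log 2)).congr fun s => ?_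
  rw [ebN0, Real.logb, Real.log_exp, inv_div, div_mul_eq_div_div, one_div, div_inv_eq_mul,
    mul_comm]

lemma strictMono_one_sub_inv_four_pow :
    StrictMono fun m : ℕ => 1 - (((2 : ℝ) ^ m) ^ 2)⁻¹ := by
  refine strictMono_nat_of_lt_succ fun m => ?_
  have : (0 : ℝ) < (2 ^ m) ^ 2 := by positivity
  have h2 : ((2 : ℝ) ^ m) ^ 2 < (2 ^ (m + 1)) ^ 2 := by
    rw [pow_succ (2 : ℝ) m, mul_pow]; linarith
  have := inv_strictAnti₀ this h2
  linarith

lemma tendsto_one_sub_inv_four_pow :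
    Tendsto (fun m : ℕ => 1 - (((2 : ℝ) ^ m) ^ 2)⁻¹) atTop (𝓝 1) := by
  have h : Tendsto (fun m : ℕ => ((2 : ℝ) ^ m) ^ 2) atTop atTop :=
    (tendsto_pow_atTop two_ne_zero).comp (tendsto_pow_atTop_atTop_of_one_lt one_lt_two)
  simpa using h.inv_tendsto_atTop.const_sub 1

lemma abs_dB_four_thirds_log_two_sub_lt :
    |dB (4 / 3 * Real.log 2) - (-0.3424)| < 0.00005 := by
  have h2l := Real.log_two_gt_d9
  have h2u := Real.log_two_lt_d9
  have h5l := Real.log_five_gt_d9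
  have h5u := Real.log_five_lt_d9
  have hlow : Real.log 0.92419624 ≤ Real.log (4 / 3 * Real.log 2) :=
    Real.log_le_log (by norm_num) (by linarith)
  have hupp : Real.log (4 / 3 * Real.log 2) ≤ Real.log 0.92419625 :=
    Real.log_le_log (by linarith) (by linarith)
  -- The number `4 / 3 * log 2` lies between `1 - 0.07580376` and `1 - 0.07580375`; five terms of
  -- the series of `log (1 - x)` are precise enough.
  have e1 := abs_le.1 (Real.abs_log_sub_add_sum_range_le (x := 0.07580376)
    (by rw [abs_of_pos] <;> norm_num) 5)
  have e2 := abs_le.1 (Real.abs_log_sub_add_sum_range_le (x := 0.07580375)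
    (by rw [abs_of_pos] <;> norm_num) 5)
  rw [show (1 : ℝ) - 0.07580376 = 0.92419624 by norm_num, abs_of_pos (by norm_num)] at e1
  rw [show (1 : ℝ) - 0.07580375 = 0.92419625 by norm_num, abs_of_pos (by norm_num)] at e2
  norm_num [Finset.sum_range_succ] at e1 e2 hlow hupp
  have h10 : 0 < Real.log 10 := Real.log_pos (by norm_num)
  have h10e := Real.log_ten_eq
  rw [dB, Real.logb, ← mul_div_assoc, sub_neg_eq_add, abs_lt]
  constructor
  · rw [← sub_lt_iff_lt_add, lt_div_iff₀ h10]
    linarith [e1.1]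
  · rw [← lt_sub_iff_add_lt, div_lt_iff₀ h10]
    linarith [e2.2]

end ZeroSNR

end BICM

end

theorem theorem3 (ν : Measure ℂ) [IsProbabilityMeasure ν] (hν : ∫ h, ‖h‖ ^ 2 ∂ν = 1)
    (C : ℕ → ℝ → ℝ) (hC : C = BICM.pamCapacity ν ∨ C = BICM.qamCapacity ν) :
    (∀ m : ℕ, 1 ≤ m → ∀ M : ℝ, M = 2 ^ m →
      BICM.HasFirstOrderExpansion (C m) (3 * M ^ 2 / (4 * (M ^ 2 - 1))) ∧
      (Integrable (fun h : ℂ => ‖h‖ ^ 4) ν →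
        ∃ c₂ : ℝ, BICM.HasSecondOrderExpansion (C m) (3 * M ^ 2 / (4 * (M ^ 2 - 1))) c₂) ∧
      BICM.firstOrderCoeff (C m) = 3 * M ^ 2 / (4 * (M ^ 2 - 1)) ∧
      BICM.ebN0Lim (C m) = 4 * (M ^ 2 - 1) / (3 * M ^ 2) * Real.log 2 ∧
      Tendsto (BICM.ebN0 (C m)) (𝓝[>] 0) (𝓝 (BICM.ebN0Lim (C m)))) ∧
    StrictMonoOn (fun m => BICM.ebN0Lim (C m)) (Set.Ici 1) ∧
    (∀ m : ℕ, 1 ≤ m → BICM.ebN0Lim (C m) < 4 / 3 * Real.log 2) ∧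
    Tendsto (fun m => BICM.ebN0Lim (C m)) atTop (𝓝 (4 / 3 * Real.log 2)) ∧
    |BICM.dB (4 / 3 * Real.log 2) - (-0.3424)| < 0.00005 := by
  have hlog : 0 < Real.log 2 := Real.log_pos one_lt_two
  have hfirst : ∀ m : ℕ, 1 ≤ m → BICM.HasFirstOrderExpansion (C m)
      (3 * ((2 : ℝ) ^ m) ^ 2 / (4 * (((2 : ℝ) ^ m) ^ 2 - 1))) := by
    intro m hm
    obtain ⟨m, rfl⟩ := Nat.exists_eq_add_of_le' hm
    rcases hC with rfl | rfl
    · exact BICM.firstOrder_pamCapacity hν m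
    · exact BICM.firstOrder_qamCapacity hν m
  have hsecond : Integrable (fun h : ℂ => ‖h‖ ^ 4) ν → ∀ m : ℕ, 1 ≤ m →
      ∃ c₂ : ℝ, BICM.HasSecondOrderExpansion (C m)
        (3 * ((2 : ℝ) ^ m) ^ 2 / (4 * (((2 : ℝ) ^ m) ^ 2 - 1))) c₂ := by
    intro h4 m hm
    obtain ⟨m, rfl⟩ := Nat.exists_eq_add_of_le' hm
    rcases hC with rfl | rfl
    · exact BICM.secondOrder_pamCapacity hν h4 m
    · exact BICM.secondOrder_qamCapacity hν h4 m
  -- In this form monotonicity, the upper bound and the limit all reduce to the factor `1 - M⁻²`.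
  have hlim : ∀ m : ℕ, 1 ≤ m → BICM.ebN0Lim (C m) =
      4 / 3 * Real.log 2 * (1 - (((2 : ℝ) ^ m) ^ 2)⁻¹) := by
    intro m hm
    rw [BICM.ebN0Lim, (hfirst m hm).firstOrderCoeff_eq, div_div_eq_mul_div]
    field_simp
  refine ⟨?_, ?_, ?_, ?_, BICM.abs_dB_four_thirds_log_two_sub_lt⟩
  · rintro m hm M rfl
    have hpos : 0 < ((2 : ℝ) ^ m) ^ 2 - 1 := by
      obtain ⟨m, rfl⟩ := Nat.exists_eq_add_of_le' hm
      exact BICM.four_pow_sub_one_pos m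
    refine ⟨hfirst m hm, fun h4 => hsecond h4 m hm, (hfirst m hm).firstOrderCoeff_eq, ?_,
      (hfirst m hm).tendsto_ebN0 (by positivity)⟩
    rw [hlim m hm]
    field_simp
  · intro m hm n hn hmn
    simp only [hlim m hm, hlim n hn]
    exact mul_lt_mul_of_pos_left (BICM.strictMono_one_sub_inv_four_pow hmn) (by positivity)
  · intro m hm
    rw [hlim m hm]
    refine mul_lt_of_lt_one_right (by positivity) (sub_lt_self _ (by positivity))
  · have h := BICM.tendsto_one_sub_inv_four_pow.const_mul (4 / 3 * Real.log 2)
    rw [mul_one] at h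
    refine h.congr' ?_
    filter_upwards [eventually_ge_atTop 1] with m hm
    rw [hlim m hm]
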